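/- Let $n\ge 1$, $m\ge 0$, and consider the MIMO system in normal form without actuator faults $$\dot x_i=x_{i+1}\ (1\le i\le n-1),\qquad \dot x_n=f(\bar x)+g(\bar x,t)\,u+d(\bar x,t),$$ with output $x_1$, where $x_i\in\mathbb R^m$, $\bar x=(x_1,\dots,x_n)$, $\bar x_{n-1}=(x_1,\dots,x_{n-1})$ and $t\ge 0$. The functions $f,d$ ($\mathbb R^m$-valued) and $g$ ($\mathbb R^{m\times m}$-valued, of unknown magnitude and sign) are unknown. *Reference.* $y^*:[0,\infty)\to\mathbb R^m$ is $n$ times differentiable, and $y^*$ and its derivatives up to order $n$ are bounded. Put $e=x_1-y^*$ and $e_i=x_i-(y^*)^{(i-1)}$, $i=1,\dots,n$ (so $e_i=e^{(i-1)}$ along solutions). *Controllability.* There are a symmetric positive definite matrix $\alpha(\bar x_{n-1},t)$, differentiable in $(\bar x_{n-1},t)$, and (unknown) constants $\bar\lambda$ and $\underline\lambda>0$ such that the smallest eigenvalue of $\alpha(\bar x_{n-1},t)$ is bounded away from $0$ uniformly in $t\ge0$ for $\bar x_{n-1}$ in bounded sets, and such that either $\underline\lambda I\preceq \alpha g+g^T\alpha\preceq\bar\lambda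 I$ for all $\bar x$ and $t\ge0$, or $\underline\lambda I\preceq -(\alpha g+g^T\alpha)\preceq\bar\lambda I$ for all $\bar x$ and $t\ge0$. *Growth.* There are unknown constants $a_f,a_1,a_2>0$ and known nonnegative functions $\varphi_f(\bar x),\varphi_1(\bar x_{n-1}),\varphi_2(\bar x)$, bounded on bounded sets, such that for all $\bar x$ and $t\ge 0$ $$\|f+d\|\le a_f\varphi_f,\qquad \|\alpha\|\le a_1\varphi_1,\qquad \Big\|\frac{\partial\alpha}{\partial t}+\sum_{j=1}^{n-1}\frac{\partial\alpha}{\partial x_j}x_{j+1}\Big\|\le a_2\varphi_2 .$$ *Controller.* Choose $\lambda_1,\dots,\lambda_{n-1}$ such that $z^{n-1}+\lambda_{n-1}z^{n-2}+\dots+\lambda_1$ is Hurwitz, constants $k,\sigma_1,\sigma_2>0$, and a function $\nu\ge 0$, integrable on each $[0,t]$, with $\sup_{t\ge 0}\int_0^t\nu<\infty$. Let $\hbar$ be a $BL$-type Nussbaum function with a constant $L>\bar\lambda/\underline\lambda$, i.e. $\hbar\in C^1([0,\infty))$ and, with $I^\pm(\zeta)=\int_0^\zeta\max\{0,\pm\hbar(\tau)\}\,d\tau$,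 one has, as $\zeta\to\infty$, $I^\pm(\zeta)/\zeta\to\infty$, $\limsup I^+/I^-\ge L$ and $\limsup I^- /I^+\ge L$ (for instance any $\hbar$ that satisfies this for every $L>1$). Put $$s=\sum_{i=1}^{n-1}\lambda_ie_i+e_n,\quad \Phi=\sum_{i=1}^{n-1}\lambda_ie_{i+1},\quad \varphi=\varphi_1(\|\Phi\|+\varphi_f+1)+\tfrac12\varphi_2\|s\|,$$ $$u=\hbar(\zeta)\eta,\qquad \eta=ks+\frac{\hat\theta\varphi^2s}{\varphi\|s\|+\nu(t)},\qquad \dot\zeta=\sigma_1s^T\eta,\qquad \dot{\hat\theta}=\frac{\sigma_2\varphi^2\|s\|^2}{\varphi\|s\|+\nu(t)},$$ where a quotient is read as $0$ if its denominator is $0$. Consider closed-loop solutions $(\bar x,\zeta,\hat\theta)$ on an interval $J\subseteq[0,\infty)$ with least element $t_0$ and with $\zeta(t_0)\ge0$, $\hat\theta(t_0)\ge0$. Then: 1. All closed-loop signals are globally uniformly bounded: for every $R$ there is $B$, depending neither on $t_0$, nor on $J$, nor on the solution, such that every closed-loop solution with $\|x_i(t_0)\|\le R$ for all $i$, $\zeta(t_0)\le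 R$, $\hat\theta(t_0)\le R$ satisfies, for all $t\in J$, that $\|x_i\|$ and $\|e_i\|$ ($1\le i\le n$), $\|s\|$, $\|\Phi\|$, $|\varphi|$, $\|\eta\|$, $\|u\|$, $|\zeta|$, $|\hat\theta|$, $|\dot\zeta|$ and $|\dot{\hat\theta}|$ are at most $B$. If, moreover, $g$ is bounded uniformly in $t\ge0$ on bounded sets of states, then the same holds for $\|\dot x_n\|$. 2. For every closed-loop solution on $[t_0,\infty)$, the tracking error $e(t)$ and its derivatives up to order $n-1$ tend to $0$ as $t\to\infty$. -/

import Mathlib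

open Filter Topology Set
open scoped Matrix.Norms.L2Operator

/-- `ℝᵐ` with the Euclidean norm. -/
abbrev Vec (m : ℕ) := EuclideanSpace ℝ (Fin m)

/-- Full states `(x₁, …, xₙ)` of a system of order `n = r + 1`; the block `xⱼ` has index `j - 1`. -/
abbrev FullState (r m : ℕ) := Fin (r + 1) → Vec m

/-- The partial state `(x₁, …, xₙ₋₁)`. -/
def lowState {r m : ℕ} (x : FullState r m) : Fin r → Vec m := fun i => x i.castSucc

/-- The shifted state `(x₂, …, xₙ)`, which is the velocity of the partial state. -/
def highState {r m : ℕ} (x : FullState r m) : Fin r → Vec m := fun i => x i.succ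

/-- Data of the plant `ẋᵢ = xᵢ₊₁`, `ẋₙ = f(x) + g(x,t) u + d(x,t)`. -/
structure Plant (r m : ℕ) where
  f : FullState r m → Vec m
  g : FullState r m → ℝ → Matrix (Fin m) (Fin m) ℝ
  d : FullState r m → ℝ → Vec m

/-- What the designer chooses or knows: the filter coefficients `λ₁, …, λₙ₋₁`, the gains, the
Nussbaum function `h`, the function `ν`, and the bounding functions `φ_f`, `φ₁`, `φ₂`. -/
structure Controller (r m : ℕ) where
  lam : Fin r → ℝ
  k : ℝ
  σ₁ : ℝ
  σ₂ : ℝ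
  h : ℝ → ℝ
  ν : ℝ → ℝ
  φf : FullState r m → ℝ
  φ₁ : (Fin r → Vec m) → ℝ
  φ₂ : FullState r m → ℝ

/-- The `i`-th derivative of the reference trajectory on `[0, ∞)`. -/
noncomputable def refDeriv {m : ℕ} (y : ℝ → Vec m) (i : ℕ) (t : ℝ) : Vec m :=
  iteratedDerivWithin i y (Ici 0) t

/-- The errors `eᵢ = xᵢ - y⁽ⁱ⁻¹⁾`, `i = 1, …, n`. -/
noncomputable def errState {r m : ℕ} (y : ℝ → Vec m) (x : FullState r m) (t : ℝ) :
    FullState r m :=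
  fun i => x i - refDeriv y i t

namespace Controller

variable {r m : ℕ}

/-- The filtered error `s = λ₁ e₁ + ⋯ + λₙ₋₁ eₙ₋₁ + eₙ`. -/
noncomputable def s (C : Controller r m) (y : ℝ → Vec m) (x : FullState r m) (t : ℝ) : Vec m :=
  ∑ i : Fin r, C.lam i • errState y x t i.castSucc + errState y x t (Fin.last r)

/-- `Φ = λ₁ e₂ + ⋯ + λₙ₋₁ eₙ`. -/
noncomputable def Phi (C : Controller r m) (y : ℝ → Vec m) (x : FullState r m) (t : ℝ) : Vec m :=
  ∑ i : Fin r, C.lam i • errState y x t i.succ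

/-- The core function `φ = φ₁ (‖Φ‖ + φ_f + 1) + ½ φ₂ ‖s‖`. -/
noncomputable def core (C : Controller r m) (y : ℝ → Vec m) (x : FullState r m) (t : ℝ) : ℝ :=
  C.φ₁ (lowState x) * (‖C.Phi y x t‖ + C.φf x + 1) + 1 / 2 * C.φ₂ x * ‖C.s y x t‖

/-- `η = k s + θ̂ φ² s / (φ ‖s‖ + ν)`; the quotient is `0` where its denominator vanishes. -/
noncomputable def eta (C : Controller r m) (y : ℝ → Vec m) (x : FullState r m) (θ t : ℝ) : Vec m :=
  C.k • C.s y x t +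
    (θ * C.core y x t ^ 2 / (C.core y x t * ‖C.s y x t‖ + C.ν t)) • C.s y x t

/-- The control law `u = h(ζ) η`. -/
noncomputable def control (C : Controller r m) (y : ℝ → Vec m) (x : FullState r m) (ζ θ t : ℝ) :
    Vec m :=
  C.h ζ • C.eta y x θ t

/-- The adaptive law for `ζ`: `σ₁ sᵀ η`. -/
noncomputable def zetaRate (C : Controller r m) (y : ℝ → Vec m) (x : FullState r m) (θ t : ℝ) : ℝ :=
  C.σ₁ * inner ℝ (C.s y x t) (C.eta y x θ t)

/-- The adaptive law for `θ̂`: `σ₂ φ² ‖s‖² / (φ ‖s‖ + ν)`. -/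
noncomputable def thetaRate (C : Controller r m) (y : ℝ → Vec m) (x : FullState r m) (t : ℝ) : ℝ :=
  C.σ₂ * C.core y x t ^ 2 * ‖C.s y x t‖ ^ 2 / (C.core y x t * ‖C.s y x t‖ + C.ν t)

end Controller

/-- The right-hand side `f(x) + g(x,t) u + d(x,t)` of the last block of the plant under the
control law. -/
noncomputable def accel {r m : ℕ} (P : Plant r m) (C : Controller r m) (y : ℝ → Vec m)
    (x : FullState r m) (ζ θ t : ℝ) : Vec m :=
  P.f x + Matrix.toEuclideanCLM (n := Fin m) (𝕜 := ℝ) (P.g x t) (C.control y x ζ θ t) + P.d x t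

/-- `(x, ζ, θ̂)` solves the closed-loop equations on the time interval `J`, starting at the least
element `t₀ ≥ 0` of `J` with `ζ(t₀) ≥ 0` and `θ̂(t₀) ≥ 0`. -/
structure IsClosedLoopSolution {r m : ℕ} (P : Plant r m) (C : Controller r m) (y : ℝ → Vec m)
    (t₀ : ℝ) (J : Set ℝ) (x : ℝ → FullState r m) (ζ θ : ℝ → ℝ) : Prop where
  start_nonneg : 0 ≤ t₀
  isLeast : IsLeast J t₀
  ordConnected : J.OrdConnected
  zeta_nonneg : 0 ≤ ζ t₀
  theta_nonneg : 0 ≤ θ t₀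
  chain : ∀ t ∈ J, ∀ i : Fin r,
    HasDerivWithinAt (fun τ => x τ i.castSucc) (x t i.succ) J t
  last : ∀ t ∈ J,
    HasDerivWithinAt (fun τ => x τ (Fin.last r)) (accel P C y (x t) (ζ t) (θ t) t) J t
  zeta : ∀ t ∈ J, HasDerivWithinAt ζ (C.zetaRate y (x t) (θ t) t) J t
  theta : ∀ t ∈ J, HasDerivWithinAt θ (C.thetaRate y (x t) t) J t

/-- A Nussbaum function of type `BL` with constant `L`. The superior limits are taken in the
extended reals. -/
structure IsBLNussbaum (L : ℝ) (h : ℝ → ℝ) : Prop where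
  contDiffOn : ContDiffOn ℝ 1 h (Ici 0)
  tendsto_pos : Tendsto (fun z : ℝ => (∫ τ in (0 : ℝ)..z, max 0 (h τ)) / z) atTop atTop
  limsup_pos : (L : EReal) ≤ limsup (fun z : ℝ =>
    (((∫ τ in (0 : ℝ)..z, max 0 (h τ)) / (∫ τ in (0 : ℝ)..z, max 0 (-h τ)) : ℝ) : EReal)) atTop
  tendsto_neg : Tendsto (fun z : ℝ => (∫ τ in (0 : ℝ)..z, max 0 (-h τ)) / z) atTop atTop
  limsup_neg : (L : EReal) ≤ limsup (fun z : ℝ =>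
    (((∫ τ in (0 : ℝ)..z, max 0 (-h τ)) / (∫ τ in (0 : ℝ)..z, max 0 (h τ)) : ℝ) : EReal)) atTop

/-- The reference is `n = r + 1` times differentiable on `[0, ∞)`, and it and its derivatives up
to order `n` are bounded there. -/
structure IsAdmissibleReference {m : ℕ} (r : ℕ) (y : ℝ → Vec m) : Prop where
  differentiableOn : ∀ i ≤ r, DifferentiableOn ℝ (refDeriv y i) (Ici 0)
  bounded : ∀ i ≤ r + 1, ∃ M : ℝ, ∀ t, 0 ≤ t → ‖refDeriv y i t‖ ≤ M

/-- Admissible design choices: the polynomial `zⁿ⁻¹ + λₙ₋₁ zⁿ⁻² + ⋯ + λ₁` is Hurwitz, the gains are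
positive, `ν ≥ 0` has bounded integral, and the bounding functions are nonnegative and bounded on
bounded sets. -/
structure Controller.IsAdmissible {r m : ℕ} (C : Controller r m) : Prop where
  hurwitz : ∀ z : ℂ, z ^ r + ∑ i : Fin r, (C.lam i : ℂ) * z ^ (i : ℕ) = 0 → z.re < 0
  k_pos : 0 < C.k
  σ₁_pos : 0 < C.σ₁
  σ₂_pos : 0 < C.σ₂
  ν_nonneg : ∀ t, 0 ≤ t → 0 ≤ C.ν t
  ν_integrable : ∀ t, 0 ≤ t → IntervalIntegrable C.ν MeasureTheory.volume 0 t
  ν_bounded : ∃ M : ℝ, ∀ t, 0 ≤ t → ∫ τ in (0 : ℝ)..t, C.ν τ ≤ M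
  φf_nonneg : ∀ x, 0 ≤ C.φf x
  φ₁_nonneg : ∀ z, 0 ≤ C.φ₁ z
  φ₂_nonneg : ∀ x, 0 ≤ C.φ₂ x
  φf_bounded : ∀ R : ℝ, ∃ M : ℝ, ∀ x, ‖x‖ ≤ R → C.φf x ≤ M
  φ₁_bounded : ∀ R : ℝ, ∃ M : ℝ, ∀ z, ‖z‖ ≤ R → C.φ₁ z ≤ M
  φ₂_bounded : ∀ R : ℝ, ∃ M : ℝ, ∀ x, ‖x‖ ≤ R → C.φ₂ x ≤ M

/-- `lo • 1 ≤ M ≤ hi • 1` in the order of symmetric matrices, that is, `M` is symmetric with all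
its eigenvalues in `[lo, hi]`. -/
def EigenvaluesIn {m : ℕ} (lo hi : ℝ) (M : Matrix (Fin m) (Fin m) ℝ) : Prop :=
  (M - lo • (1 : Matrix (Fin m) (Fin m) ℝ)).PosSemidef ∧
    (hi • (1 : Matrix (Fin m) (Fin m) ℝ) - M).PosSemidef

/-- `α(x₁, …, xₙ₋₁, t)` is an auxiliary matrix for the plant: it is differentiable, symmetric and
positive definite, uniformly in `t ≥ 0` and in bounded sets of partial states, and either
`α g + gᵀ α` has all eigenvalues in `[lo, hi]`, or it has all of them in `[-hi, -lo]`. -/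
structure IsAuxiliaryMatrix {r m : ℕ} (P : Plant r m)
    (α : (Fin r → Vec m) → ℝ → Matrix (Fin m) (Fin m) ℝ) (lo hi : ℝ) : Prop where
  differentiableOn : DifferentiableOn ℝ
    (fun p : (Fin r → Vec m) × ℝ => α p.1 p.2) (univ ×ˢ Ici 0)
  posDef : ∀ z t, 0 ≤ t → (α z t).PosDef
  locally_uniform : ∀ R : ℝ, ∃ c : ℝ, 0 < c ∧ ∀ z t, ‖z‖ ≤ R → 0 ≤ t →
    (α z t - c • (1 : Matrix (Fin m) (Fin m) ℝ)).PosSemidef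
  definite :
    (∀ x t, 0 ≤ t → EigenvaluesIn lo hi
      (α (lowState x) t * P.g x t + (P.g x t).transpose * α (lowState x) t)) ∨
    (∀ x t, 0 ≤ t → EigenvaluesIn (-hi) (-lo)
      (α (lowState x) t * P.g x t + (P.g x t).transpose * α (lowState x) t))

/-- The total time derivative `∂α/∂t + ∑ⱼ (∂α/∂xⱼ) xⱼ₊₁` of `α` along the plant. -/
noncomputable def totalDeriv {r m : ℕ} (α : (Fin r → Vec m) → ℝ → Matrix (Fin m) (Fin m) ℝ)
    (x : FullState r m) (t : ℝ) : Matrix (Fin m) (Fin m) ℝ :=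
  fderivWithin ℝ (fun p : (Fin r → Vec m) × ℝ => α p.1 p.2) (univ ×ˢ Ici 0) (lowState x, t)
    (highState x, 1)

/-- The growth conditions, with unknown positive constants `a_f`, `a₁`, `a₂`. Matrices carry the
operator norm induced by the Euclidean norm. -/
def GrowthBounds {r m : ℕ} (P : Plant r m) (C : Controller r m)
    (α : (Fin r → Vec m) → ℝ → Matrix (Fin m) (Fin m) ℝ) : Prop :=
  ∃ af a₁ a₂ : ℝ, 0 < af ∧ 0 < a₁ ∧ 0 < a₂ ∧
    (∀ x t, 0 ≤ t → ‖P.f x + P.d x t‖ ≤ af * C.φf x) ∧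
    (∀ z t, 0 ≤ t → ‖α z t‖ ≤ a₁ * C.φ₁ z) ∧
    (∀ x t, 0 ≤ t → ‖totalDeriv α x t‖ ≤ a₂ * C.φ₂ x)

/-- All signals of the closed loop at time `t` are bounded by `B`: the states, the errors, `s`,
`Φ`, `φ`, `η`, the control input, the adaptive parameters and their rates. -/
def SignalsBoundedBy {r m : ℕ} (C : Controller r m) (y : ℝ → Vec m) (B : ℝ)
    (x : FullState r m) (ζ θ t : ℝ) : Prop :=
  (∀ i, ‖x i‖ ≤ B) ∧ (∀ i, ‖errState y x t i‖ ≤ B) ∧ ‖C.s y x t‖ ≤ B ∧ ‖C.Phi y x t‖ ≤ B ∧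
    |C.core y x t| ≤ B ∧ ‖C.eta y x θ t‖ ≤ B ∧ ‖C.control y x ζ θ t‖ ≤ B ∧
    |ζ| ≤ B ∧ |θ| ≤ B ∧ |C.zetaRate y x θ t| ≤ B ∧ |C.thetaRate y x t| ≤ B

/-! ### Energy certificates, Barbalat's lemma and first-order filters -/

section Certificates

/-! The proof rests on the Lyapunov function V = sᵀαs. The growth conditions bound every term of V'
except the control term by c φ‖s‖. The control term is at most (hi h⁺ − lo h⁻)(ζ) ζ'/σ₁, with h
replaced by −h when αg + gᵀα is negative definite (`exists_lyapunov_deriv_le`). Since φ‖s‖ ≤ θ̂'/σ₂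
+ ν, and θ̂² grows at most linearly in ζ, integration yields V ≤ c₀ + c₁ζ + (hi I⁺ − lo I⁻)(ζ)/σ₁
(`exists_lyapunov_le`). Because L > hi/lo, the right side is negative at some level z above the
initial value of ζ. As V ≥ 0, ζ never reaches z, which bounds ζ, θ̂ and V uniformly
(`exists_parameter_bound`).

From ζ' ≥ σ₁k‖s‖² and the bound on ζ it follows that s has finite energy. The error e is the output
of a stable linear filter driven by s. Factoring the Hurwitz polynomial over ℂ reduces the filter to
a cascade of first-order ones, each mapping finite energy to bounded outputs of finite energy
(`EnergyBoundedOn.first_order`, `jet_bounded`). So the errors below the top order are bounded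
without a pointwise bound on s. This confines the partial state to a bounded set, on which α is
uniformly positive, and V then controls s and the top error (`exists_state_bound`).

For convergence, V is at most a multiple of ζ' and V' is bounded above, so Barbalat's lemma gives V
→ 0 and hence s → 0; the filter cascade carries this over to the errors (`jet_tendsto_zero`).
Barbalat's lemma is applied to V rather than to s because only αg + gᵀα, not g, is bounded, so s'
may be unbounded. -/

theorem monotoneOn_of_hasDerivWithinAt_self {J : Set ℝ} (hJ : J.OrdConnected) {F F' : ℝ → ℝ}
    (hF : ∀ t ∈ J, HasDerivWithinAt F (F' t) J t) (hF' : ∀ t ∈ J, 0 ≤ F' t) : MonotoneOn F J :=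
  monotoneOn_of_hasDerivWithinAt_nonneg hJ.convex (fun t ht => (hF t ht).continuousWithinAt)
    (fun t ht => (hF t (interior_subset ht)).mono interior_subset)
    (fun t ht => hF' t (interior_subset ht))

/-- A differential certificate that the energy `∫ ‖v‖²` over `J` is at most `K`. -/
def EnergyBoundedOn {E : Type*} [Norm E] (J : Set ℝ) (v : ℝ → E) (K : ℝ) : Prop :=
  ∃ F F' : ℝ → ℝ, (∀ t ∈ J, HasDerivWithinAt F (F' t) J t) ∧ (∀ t ∈ J, ‖v t‖ ^ 2 ≤ F' t) ∧
    ∀ t ∈ J, 0 ≤ F t ∧ F t ≤ K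

/-- Barbalat's lemma for a nonnegative function whose derivative is bounded above. -/
theorem tendsto_zero_of_le_deriv {t₀ c K : ℝ} {V V' F F' : ℝ → ℝ}
    (hV : ∀ t ∈ Ici t₀, HasDerivWithinAt V (V' t) (Ici t₀) t) (hV' : ∀ t ∈ Ici t₀, V' t ≤ c)
    (hV0 : ∀ t ∈ Ici t₀, 0 ≤ V t)
    (hF : ∀ t ∈ Ici t₀, HasDerivWithinAt F (F' t) (Ici t₀) t)
    (hF' : ∀ t ∈ Ici t₀, V t ≤ F' t) (hFK : ∀ t ∈ Ici t₀, F t ≤ K) :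
    Tendsto V atTop (𝓝 0) := by
  have hoc : (Ici t₀).OrdConnected := ordConnected_Ici
  have hmono : MonotoneOn F (Ici t₀) :=
    monotoneOn_of_hasDerivWithinAt_self hoc hF fun t ht => (hV0 t ht).trans (hF' t ht)
  have hFlim : ∃ l, Tendsto F atTop (𝓝 l) := by
    have h1 : Monotone fun t => F (max t₀ t) := fun a b hab =>
      hmono (mem_Ici.2 (le_max_left _ _)) (mem_Ici.2 (le_max_left _ _)) (max_le_max le_rfl hab)
    refine ⟨_, (tendsto_atTop_ciSup h1 ⟨K, ?_⟩).congr' ?_⟩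
    · rintro _ ⟨t, rfl⟩
      exact hFK _ (mem_Ici.2 (le_max_left _ _))
    · filter_upwards [eventually_ge_atTop t₀] with t ht
      rw [max_eq_right ht]
  obtain ⟨l, hl⟩ := hFlim
  -- A strictly positive slope bound is needed to define the window length δ.
  obtain ⟨c', hc', hcc⟩ : ∃ c', 0 < c' ∧ c ≤ c' := ⟨max 1 c, by positivity, le_max_right _ _⟩
  rw [Metric.tendsto_atTop]
  intro ε hε
  set δ := ε / (2 * c') with hδ
  have hδ0 : 0 < δ := by positivity
  have hdiff : Tendsto (fun t => F t - F (t - δ)) atTop (𝓝 (l - l)) :=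
    hl.sub (hl.comp (tendsto_atTop_add_const_right _ (-δ) tendsto_id))
  rw [sub_self] at hdiff
  have hev := (hdiff.eventually (gt_mem_nhds (show (0 : ℝ) < δ * (ε / 2) by positivity))).and
    (eventually_ge_atTop (t₀ + δ))
  obtain ⟨N, hN⟩ := eventually_atTop.1 hev
  refine ⟨N, fun t ht => ?_⟩
  obtain ⟨h1, h2⟩ := hN t ht
  have ht0 : t ∈ Ici t₀ := by simp only [mem_Ici]; linarith
  rw [Real.dist_eq, sub_zero, abs_of_nonneg (hV0 t ht0)]
  by_contra! hge
  have hsub : Icc (t - δ) t ⊆ Ici t₀ := fun τ hτ => by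
    simp only [mem_Ici]; linarith [hτ.1]
  -- Only the upper bound on V' is available, so the argument looks backwards: V rises by at most
  -- c'δ = ε/2 on the window that ends at t.
  have hVlow : ∀ τ ∈ Icc (t - δ) t, ε / 2 ≤ V τ := by
    intro τ hτ
    have hm : MonotoneOn (fun t => c' * t - V t) (Ici t₀) :=
      monotoneOn_of_hasDerivWithinAt_self (F' := fun t => c' * 1 - V' t) hoc
        (fun u hu => ((hasDerivWithinAt_id u _).const_mul c').sub (hV u hu))
        (fun u hu => by linarith [hV' u hu])
    have := hm (hsub hτ) ht0 hτ.2
    have h3 : c' * (t - τ) ≤ c' * δ := by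
      gcongr; linarith [hτ.1]
    have h4 : c' * δ = ε / 2 := by rw [hδ]; field_simp
    simp only at this
    nlinarith
  -- Over this window F gains at least δε/2, contradicting the convergence of F.
  have hm : MonotoneOn (fun τ => F τ - ε / 2 * τ) (Icc (t - δ) t) :=
    monotoneOn_of_hasDerivWithinAt_self (F' := fun t => F' t - ε / 2 * 1) ordConnected_Icc
      (fun u hu => ((hF u (hsub hu)).mono hsub).sub ((hasDerivWithinAt_id u _).const_mul _))
      (fun u hu => by linarith [hF' u (hsub hu), hVlow u hu])
  have := hm ⟨le_rfl, by linarith⟩ ⟨by linarith, le_rfl⟩ (by linarith : t - δ ≤ t)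
  simp only at this
  nlinarith

/-- Young's inequality splits the cross term 2⟨w, v⟩ so that half of the decay −2a‖w‖² survives.
That half later yields the energy of `w`. -/
theorem hasDerivWithinAt_normSq_linear {z : ℂ} {w v : ℝ → ℂ} {J : Set ℝ} {t : ℝ}
    (hw : HasDerivWithinAt w (z * w t + v t) J t) :
    ∃ q, HasDerivWithinAt (fun τ => ‖w τ‖ ^ 2) q J t ∧
      ∀ a, 0 < a → a = -z.re → q ≤ -(a * ‖w t‖ ^ 2) + ‖v t‖ ^ 2 / a := by
  refine ⟨_, hw.norm_sq, ?_⟩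
  intro a ha haz
  have h1 : inner ℝ (w t) (z * w t + v t) = z.re * ‖w t‖ ^ 2 + inner ℝ (w t) (v t) := by
    rw [inner_add_right]
    congr 1
    rw [Complex.inner, ← Complex.normSq_eq_norm_sq, Complex.normSq_apply]
    simp
    ring
  rw [h1]
  have h2 := real_inner_le_norm (w t) (v t)
  have h3 : 2 * (‖w t‖ * ‖v t‖) ≤ a * ‖w t‖ ^ 2 + ‖v t‖ ^ 2 / a := by
    have : 0 ≤ (a * ‖w t‖ - ‖v t‖) ^ 2 / a := by positivity
    have h4 : (a * ‖w t‖ - ‖v t‖) ^ 2 / a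
        = a * ‖w t‖ ^ 2 + ‖v t‖ ^ 2 / a - 2 * (‖w t‖ * ‖v t‖) := by
      field_simp; ring
    linarith
  have h5 : z.re = -a := by linarith
  rw [h5]
  linarith

/-- A stable scalar first-order filter maps inputs of bounded energy to bounded outputs of bounded
energy. -/
theorem EnergyBoundedOn.first_order {z : ℂ} {w v : ℝ → ℂ} {J : Set ℝ} {t₀ a K A : ℝ}
    (ha : 0 < a) (haz : a = -z.re) (hJ : J.OrdConnected) (ht₀ : IsLeast J t₀)
    (hv : EnergyBoundedOn J v K) (hw : ∀ t ∈ J, HasDerivWithinAt w (z * w t + v t) J t)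
    (hA : ‖w t₀‖ ^ 2 ≤ A) :
    (∀ t ∈ J, ‖w t‖ ^ 2 ≤ K / a + A) ∧ EnergyBoundedOn J w ((K / a + A) / a) := by
  obtain ⟨F, F', hF, hFv, hFK⟩ := hv
  choose! q hq hq' using fun t ht => hasDerivWithinAt_normSq_linear (hw t ht)
  -- The differential inequality is solved for ‖w‖²: this G has derivative at least ‖w‖² and is
  -- nonnegative at `t₀` by the choice of `A`. Its nonnegativity gives the pointwise bound, and G
  -- itself is the certificate for `w`.
  have hG : ∀ t ∈ J, HasDerivWithinAt (fun τ => (F τ / a - ‖w τ‖ ^ 2 + A) / a)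
      ((F' t / a - q t) / a) J t := fun t ht =>
    ((((hF t ht).div_const a).sub (hq t ht)).add_const A).div_const a
  have hG' : ∀ t ∈ J, ‖w t‖ ^ 2 ≤ (F' t / a - q t) / a := by
    intro t ht
    rw [le_div_iff₀ ha]
    have h1 := hq' t ht a ha haz
    have h2 : ‖v t‖ ^ 2 / a ≤ F' t / a := by gcongr; exact hFv t ht
    linarith
  have hmono := monotoneOn_of_hasDerivWithinAt_self hJ hG
    fun t ht => (sq_nonneg _).trans (hG' t ht)
  have hG0 : ∀ t ∈ J, 0 ≤ (F t / a - ‖w t‖ ^ 2 + A) / a := by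
    intro t ht
    refine le_trans ?_ (hmono ht₀.1 ht (ht₀.2 ht))
    have := div_nonneg (hFK t₀ ht₀.1).1 ha.le
    exact div_nonneg (by linarith) ha.le
  have hb : ∀ t ∈ J, ‖w t‖ ^ 2 ≤ K / a + A := by
    intro t ht
    have h1 := hG0 t ht
    rw [le_div_iff₀ ha] at h1
    have h2 : F t / a ≤ K / a := by gcongr; exact (hFK t ht).2
    linarith
  refine ⟨hb, _, _, hG, hG', fun t ht => ⟨hG0 t ht, ?_⟩⟩
  have h2 : F t / a ≤ K / a := by gcongr; exact (hFK t ht).2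
  have := sq_nonneg ‖w t‖
  gcongr
  linarith

end Certificates

/-! ### Constant-coefficient differential operators, factored into first-order ones -/

section Jets

open Polynomial

/-- The value of the differential operator `p(D)` on a jet `e`. -/
noncomputable def jetEval (p : ℂ[X]) (e : ℕ → ℝ → ℂ) (t : ℝ) : ℂ :=
  p.sum fun i a => a * e i t

theorem jetEval_eq_sum {p : ℂ[X]} {d : ℕ} (hp : p.natDegree < d) (e : ℕ → ℝ → ℂ) (t : ℝ) :
    jetEval p e t = ∑ i ∈ Finset.range d, p.coeff i * e i t :=
  Polynomial.sum_over_range' p (f := fun i a => a * e i t) (fun _ => zero_mul _) d hp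

theorem jetEval_X_sub_C_mul (p : ℂ[X]) (z : ℂ) (e : ℕ → ℝ → ℂ) (t : ℝ) :
    jetEval ((X - C z) * p) e t =
      ∑ i ∈ Finset.range (p.natDegree + 1), p.coeff i * e (i + 1) t - z * jetEval p e t := by
  have hd : ((X - C z) * p).natDegree < p.natDegree + 2 :=
    lt_of_le_of_lt natDegree_mul_le (by rw [natDegree_X_sub_C]; omega)
  rw [jetEval_eq_sum hd, jetEval_eq_sum (show p.natDegree < p.natDegree + 2 by omega)]
  simp only [sub_mul, coeff_sub, Finset.sum_sub_distrib, coeff_C_mul]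
  rw [Finset.sum_range_succ' (fun i => (X * p : ℂ[X]).coeff i * e i t) (p.natDegree + 1)]
  simp [coeff_X_mul, Finset.mul_sum, mul_assoc]

/-- Multiplication by X shifts the jet, so (X − z)p acts as p(D) followed by d/dt − z. Thus peeling
off one root leaves a scalar first-order filter with state p(D)e. -/
theorem jetEval_hasDerivWithinAt {p : ℂ[X]} {d : ℕ} (hp : p.natDegree + 1 = d) (z : ℂ)
    {e : ℕ → ℝ → ℂ} {J : Set ℝ} {t : ℝ}
    (he : ∀ i < d, HasDerivWithinAt (e i) (e (i + 1) t) J t) :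
    HasDerivWithinAt (jetEval p e) (z * jetEval p e t + jetEval ((X - C z) * p) e t) J t := by
  have h1 : jetEval p e = fun τ => ∑ i ∈ Finset.range d, p.coeff i * e i τ := by
    funext τ; exact jetEval_eq_sum (by omega) e τ
  rw [jetEval_X_sub_C_mul, add_sub_cancel, h1, hp]
  exact HasDerivWithinAt.fun_sum fun i hi => (he i (Finset.mem_range.1 hi)).const_mul _

/-- The monic polynomial with the given roots. -/
noncomputable def rootPoly (Z : Multiset ℂ) : ℂ[X] := (Z.map fun z => X - C z).prod

theorem rootPoly_cons (z : ℂ) (Z : Multiset ℂ) :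
    rootPoly (z ::ₘ Z) = (X - C z) * rootPoly Z := by
  simp [rootPoly]

theorem rootPoly_monic (Z : Multiset ℂ) : (rootPoly Z).Monic :=
  monic_multiset_prod_of_monic _ _ fun z _ => monic_X_sub_C z

theorem rootPoly_natDegree (Z : Multiset ℂ) : (rootPoly Z).natDegree = Z.card :=
  natDegree_multiset_prod_X_sub_C_eq_card Z

theorem jetEval_rootPoly (Z : Multiset ℂ) (e : ℕ → ℝ → ℂ) (t : ℝ) :
    jetEval (rootPoly Z) e t =
      ∑ i ∈ Finset.range Z.card, (rootPoly Z).coeff i * e i t + e Z.card t := by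
  rw [jetEval_eq_sum (d := Z.card + 1) (by rw [rootPoly_natDegree]; omega),
    Finset.sum_range_succ]
  have : (rootPoly Z).coeff Z.card = 1 := by
    rw [← rootPoly_natDegree]; exact rootPoly_monic Z
  rw [this, one_mul]

/-- Jets are bounded in terms of their initial values and of the energy of a Hurwitz differential
operator applied to them. -/
theorem jet_bounded (Z : Multiset ℂ) (hZ : ∀ z ∈ Z, z.re < 0) :
    ∀ A K : ℝ, ∃ B : ℝ, ∀ (t₀ : ℝ) (J : Set ℝ) (e : ℕ → ℝ → ℂ), IsLeast J t₀ → J.OrdConnected →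
      (∀ i < Z.card, ∀ t ∈ J, HasDerivWithinAt (e i) (e (i + 1) t) J t) →
      (∀ i < Z.card, ‖e i t₀‖ ≤ A) → EnergyBoundedOn J (jetEval (rootPoly Z) e) K →
      ∀ i < Z.card, ∀ t ∈ J, ‖e i t‖ ≤ B := by
  induction Z using Multiset.induction with
  | empty => exact fun A K => ⟨0, by simp⟩
  | cons z Z ih =>
    intro A K
    have hz : z.re < 0 := hZ z (Multiset.mem_cons_self z Z)
    set p := rootPoly Z with hp
    set S := ∑ i ∈ Finset.range (Z.card + 1), ‖p.coeff i‖ with hS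
    obtain ⟨B, hB⟩ := ih (fun w hw => hZ w (Multiset.mem_cons_of_mem hw)) A
      ((K / (-z.re) + (S * A) ^ 2) / (-z.re))
    -- `B` serves the lower entries of the jet. The top entry equals p(D)e minus lower-order terms
    -- because p is monic; the two summands bound these.
    refine ⟨max B (Real.sqrt (K / (-z.re) + (S * A) ^ 2) + S * |B|), ?_⟩
    intro t₀ J e ht₀ hJ he hA hK
    rw [Multiset.card_cons] at he hA ⊢
    rw [rootPoly_cons] at hK
    have hp1 : p.natDegree + 1 = Z.card + 1 := by rw [hp, rootPoly_natDegree]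
    have hinit : ‖jetEval p e t₀‖ ≤ S * A := by
      rw [jetEval_eq_sum (d := Z.card + 1) (by omega), hS, Finset.sum_mul]
      refine (norm_sum_le _ _).trans (Finset.sum_le_sum fun i hi => ?_)
      rw [norm_mul]
      gcongr
      exact hA i (Finset.mem_range.1 hi)
    -- One filter stage passes the finite energy from ((X − z)p)(D)e to p(D)e, which is the input of
    -- the induction hypothesis.
    obtain ⟨h1, h2⟩ := hK.first_order (w := jetEval p e) (A := (S * A) ^ 2) (neg_pos.2 hz) rfl
      hJ ht₀ (fun t ht => jetEval_hasDerivWithinAt hp1 z fun i hi => he i hi t ht)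
      (by gcongr)
    have hlow := hB t₀ J e ht₀ hJ (fun i hi => he i (by omega)) (fun i hi => hA i (by omega)) h2
    intro i hi t ht
    rcases Nat.lt_succ_iff_lt_or_eq.1 hi with hi | rfl
    · exact (hlow i hi t ht).trans (le_max_left _ _)
    refine le_trans ?_ (le_max_right _ _)
    have h3 := jetEval_rootPoly Z e t
    rw [← hp] at h3
    rw [show e Z.card t = jetEval p e t - ∑ i ∈ Finset.range Z.card, p.coeff i * e i t by
      rw [h3]; ring]
    refine (norm_sub_le _ _).trans (add_le_add (Real.le_sqrt_of_sq_le (h1 t ht)) ?_)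
    refine (norm_sum_le _ _).trans ?_
    rw [hS, Finset.sum_mul, Finset.sum_range_succ]
    refine le_trans (Finset.sum_le_sum fun i hi => ?_) (le_add_of_nonneg_right (by positivity))
    rw [norm_mul]
    gcongr
    exact (hlow i (Finset.mem_range.1 hi) t ht).trans (le_abs_self B)

/-- Jets tend to zero if a Hurwitz differential operator maps them to a bounded function of finite
energy. -/
theorem jet_tendsto_zero (Z : Multiset ℂ) (hZ : ∀ z ∈ Z, z.re < 0) {t₀ : ℝ} {e : ℕ → ℝ → ℂ} :
    ∀ K M : ℝ, (∀ i < Z.card, ∀ t ∈ Ici t₀, HasDerivWithinAt (e i) (e (i + 1) t) (Ici t₀) t) →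
      EnergyBoundedOn (Ici t₀) (jetEval (rootPoly Z) e) K →
      (∀ t ∈ Ici t₀, ‖jetEval (rootPoly Z) e t‖ ≤ M) →
      ∀ i < Z.card, Tendsto (e i) atTop (𝓝 0) := by
  induction Z using Multiset.induction with
  | empty => simp
  | cons z Z ih =>
    intro K M he hK hM
    have hz : z.re < 0 := hZ z (Multiset.mem_cons_self z Z)
    set p := rootPoly Z with hp
    rw [Multiset.card_cons] at he ⊢
    rw [rootPoly_cons] at hK hM
    have hp1 : p.natDegree + 1 = Z.card + 1 := by rw [hp, rootPoly_natDegree]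
    have hder : ∀ t ∈ Ici t₀, HasDerivWithinAt (jetEval p e)
        (z * jetEval p e t + jetEval ((X - C z) * p) e t) (Ici t₀) t :=
      fun t ht => jetEval_hasDerivWithinAt hp1 z fun i hi => he i hi t ht
    have hz' : 0 < -z.re := neg_pos.2 hz
    obtain ⟨h1, h2⟩ := hK.first_order (w := jetEval p e) hz' rfl
      ordConnected_Ici isLeast_Ici hder le_rfl
    have hlow := ih (fun w hw => hZ w (Multiset.mem_cons_of_mem hw)) _ _
      (fun i hi => he i (by omega)) h2 (fun t ht => Real.le_sqrt_of_sq_le (h1 t ht))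
    intro i hi
    rcases Nat.lt_succ_iff_lt_or_eq.1 hi with hi | rfl
    · exact hlow i hi
    -- Barbalat's lemma for ‖p(D)e‖²: it is integrable in the sense of `h2`, and the bound `M` on
    -- the input bounds its derivative above.
    have hw : Tendsto (jetEval p e) atTop (𝓝 0) := by
      obtain ⟨F, F', hF, hF', hFK⟩ := h2
      choose! q hq hq' using fun t ht => hasDerivWithinAt_normSq_linear (hder t ht)
      have hsq := tendsto_zero_of_le_deriv (c := M ^ 2 / (-z.re)) hq (fun t ht => ?_)
        (fun t ht => sq_nonneg _) hF hF' (fun t ht => (hFK t ht).2)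
      · rw [tendsto_zero_iff_norm_tendsto_zero]
        have := hsq.sqrt
        simpa using this
      · refine (hq' t ht _ hz' rfl).trans ?_
        have h3 : ‖jetEval ((X - C z) * p) e t‖ ^ 2 / (-z.re) ≤ M ^ 2 / (-z.re) := by
          gcongr; exact hM t ht
        have : 0 ≤ -z.re * ‖jetEval p e t‖ ^ 2 := by positivity
        linarith
    have h4 : Tendsto (fun t => jetEval p e t - ∑ i ∈ Finset.range Z.card, p.coeff i * e i t)
        atTop (𝓝 (0 - ∑ i ∈ Finset.range Z.card, p.coeff i * 0)) :=
      hw.sub (tendsto_finsetSum _ fun i hi => (hlow i (Finset.mem_range.1 hi)).const_mul _)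
    simp only [mul_zero, Finset.sum_const_zero, sub_zero] at h4
    refine h4.congr fun t => ?_
    rw [hp, jetEval_rootPoly Z e t]
    ring

end Jets

/-! ### Nussbaum gains -/

section Nussbaum

/-- The weighted combination `b I⁺ - a I⁻` of the integrals of the positive and the negative part
of `h`, where `h` is extended to the left of `0` by a constant. -/
noncomputable def nussbaumGain (b a : ℝ) (h : ℝ → ℝ) (z : ℝ) : ℝ :=
  ∫ τ in (0 : ℝ)..z, (b * max 0 (h (max 0 τ)) - a * max 0 (-h (max 0 τ)))

theorem continuous_comp_max_zero {h : ℝ → ℝ} (hh : ContinuousOn h (Ici 0)) :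
    Continuous fun τ => h (max 0 τ) :=
  hh.comp_continuous (continuous_const.max continuous_id) fun τ => mem_Ici.2 (le_max_left 0 τ)

/-- The constant extension of `h` makes the integrand continuous on the whole line, so the
derivative is two-sided even at 0, where ζ may start. -/
theorem hasDerivAt_nussbaumGain {h : ℝ → ℝ} (hh : ContinuousOn h (Ici 0)) (b a : ℝ) {z : ℝ}
    (hz : 0 ≤ z) :
    HasDerivAt (nussbaumGain b a h) (b * max 0 (h z) - a * max 0 (-h z)) z := by
  have hc := continuous_comp_max_zero hh
  have hc' : Continuous fun τ => b * max 0 (h (max 0 τ)) - a * max 0 (-h (max 0 τ)) :=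
    (continuous_const.mul (continuous_const.max hc)).sub
      (continuous_const.mul (continuous_const.max hc.neg))
  have := (hc'.integral_hasStrictDerivAt 0 z).hasDerivAt
  rw [max_eq_right hz] at this
  exact this

theorem nussbaumGain_eq {h : ℝ → ℝ} (hh : ContinuousOn h (Ici 0)) (b a : ℝ) {z : ℝ}
    (hz : 0 ≤ z) :
    nussbaumGain b a h z =
      b * (∫ τ in (0 : ℝ)..z, max 0 (h τ)) - a * ∫ τ in (0 : ℝ)..z, max 0 (-h τ) := by
  have hc := continuous_comp_max_zero hh
  have e1 : ∫ τ in (0 : ℝ)..z, max 0 (h τ) = ∫ τ in (0 : ℝ)..z, max 0 (h (max 0 τ)) :=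
    intervalIntegral.integral_congr fun τ hτ => by
      rw [uIcc_of_le hz] at hτ; simp [max_eq_right hτ.1]
  have e2 : ∫ τ in (0 : ℝ)..z, max 0 (-h τ) = ∫ τ in (0 : ℝ)..z, max 0 (-h (max 0 τ)) :=
    intervalIntegral.integral_congr fun τ hτ => by
      rw [uIcc_of_le hz] at hτ; simp [max_eq_right hτ.1]
  rw [e1, e2, nussbaumGain, intervalIntegral.integral_sub, intervalIntegral.integral_const_mul,
    intervalIntegral.integral_const_mul]
  · exact (continuous_const.mul (continuous_const.max hc)).intervalIntegrable _ _
  · exact (continuous_const.mul (continuous_const.max hc.neg)).intervalIntegrable _ _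

/-- If `L > hi / lo` and `p`, `n` are superlinear with `limsup n / p ≥ L`, then `hi p - lo n` is
frequently below any given affine function. -/
theorem exists_gain_lt {lo hi L : ℝ} (hlo : 0 < lo) (hL : hi / lo < L) {p n : ℝ → ℝ}
    (hp : Tendsto (fun z => p z / z) atTop atTop) (hn : Tendsto (fun z => n z / z) atTop atTop)
    (hlim : (L : EReal) ≤ limsup (fun z => ((n z / p z : ℝ) : EReal)) atTop) (c₀ c₁ R : ℝ) :
    ∃ z, R ≤ z ∧ 0 < z ∧ hi * p z - lo * n z < c₀ + c₁ * z := by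
  obtain ⟨δ, hδ, hfr⟩ : ∃ δ > 0, ∃ᶠ z in atTop, hi * p z - lo * n z ≤ -(δ * n z) := by
    have hpp : ∀ᶠ z in atTop, 0 < p z := by
      filter_upwards [hp.eventually_gt_atTop 0, eventually_gt_atTop (0 : ℝ)] with z h1 h2
      exact (div_pos_iff_of_pos_right h2).1 h1
    -- Eigenvalue bounds force `lo ≤ hi` when m > 0, so in the application this case can occur only
    -- for m = 0.
    by_cases hhi : hi ≤ 0
    · refine ⟨lo, hlo, Eventually.frequently ?_⟩
      filter_upwards [hpp] with z hz
      nlinarith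
    push Not at hhi
    -- The strict gap leaves room: n > L'p infinitely often, so hi p ≤ (hi/L') n, and a fraction δ =
    -- lo − hi/L' > 0 of n remains to beat any affine function.
    obtain ⟨L', h1, h2⟩ := exists_between hL
    have hL' : 0 < L' := (div_pos hhi hlo).trans h1
    have hf : ∃ᶠ z in atTop, ((L' : ℝ) : EReal) < ((n z / p z : ℝ) : EReal) :=
      frequently_lt_of_lt_limsup (by isBoundedDefault)
        (lt_of_lt_of_le (EReal.coe_lt_coe_iff.2 h2) hlim)
    refine ⟨lo - hi / L', ?_, (hf.and_eventually hpp).mono ?_⟩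
    · rw [gt_iff_lt, sub_pos, div_lt_iff₀ hL']
      rwa [div_lt_iff₀ hlo, mul_comm] at h1
    · rintro z ⟨h3, h4⟩
      rw [EReal.coe_lt_coe_iff, lt_div_iff₀ h4] at h3
      have h5 : hi / L' * (L' * p z) ≤ hi / L' * n z := by gcongr
      have h6 : hi / L' * (L' * p z) = hi * p z := by field_simp
      linarith
  have hev : ∀ᶠ z in atTop, -(δ * n z) < c₀ + c₁ * z := by
    filter_upwards [hn.eventually_gt_atTop ((|c₀| + |c₁|) / δ), eventually_ge_atTop (1 : ℝ)]
      with z h1 h2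
    have hz : 0 < z := by linarith
    rw [div_lt_div_iff₀ hδ hz] at h1
    have := neg_abs_le c₀
    have h3 : -(|c₁| * z) ≤ c₁ * z := by nlinarith [neg_abs_le c₁]
    nlinarith [abs_nonneg c₀]
  obtain ⟨z, h1, h2, h3, h4⟩ := (hfr.and_eventually
    (hev.and ((eventually_ge_atTop R).and (eventually_gt_atTop (0 : ℝ))))).exists
  exact ⟨z, h3, h4, h1.trans_lt h2⟩

theorem IsBLNussbaum.exists_nussbaumGain_lt {lo hi L : ℝ} {h : ℝ → ℝ} (hN : IsBLNussbaum L h)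
    (hlo : 0 < lo) (hL : hi / lo < L) (c₀ c₁ R : ℝ) :
    ∃ z, R ≤ z ∧ 0 < z ∧ nussbaumGain hi lo h z < c₀ + c₁ * z := by
  obtain ⟨z, h1, h2, h3⟩ := exists_gain_lt hlo hL hN.tendsto_pos hN.tendsto_neg hN.limsup_neg
    c₀ c₁ R
  exact ⟨z, h1, h2, by rwa [nussbaumGain_eq hN.contDiffOn.continuousOn _ _ h2.le]⟩

/-- This symmetry is what makes the controller indifferent to the unknown sign of the gain matrix.
-/
theorem IsBLNussbaum.neg {L : ℝ} {h : ℝ → ℝ} (hN : IsBLNussbaum L h) :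
    IsBLNussbaum L fun z => -h z where
  contDiffOn := hN.contDiffOn.neg
  tendsto_pos := hN.tendsto_neg
  limsup_pos := by simpa using hN.limsup_neg
  tendsto_neg := by simpa using hN.tendsto_pos
  limsup_neg := by simpa using hN.limsup_pos

end Nussbaum

/-! ### Matrices acting on Euclidean space and their quadratic forms -/

section QuadraticForms

open Matrix

variable {m : ℕ}

/-- The linear map `A ↦ (v ↦ A v)` on Euclidean space as a continuous linear map. -/
noncomputable def matrixAction (m : ℕ) : Matrix (Fin m) (Fin m) ℝ →L[ℝ] (Vec m →L[ℝ] Vec m) :=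
  LinearMap.toContinuousLinearMap
    (toEuclideanCLM (n := Fin m) (𝕜 := ℝ)).toAlgEquiv.toLinearMap

theorem matrixAction_apply (A : Matrix (Fin m) (Fin m) ℝ) :
    matrixAction m A = toEuclideanCLM (n := Fin m) (𝕜 := ℝ) A := rfl

theorem norm_matrixAction (A : Matrix (Fin m) (Fin m) ℝ) : ‖matrixAction m A‖ = ‖A‖ := rfl

theorem inner_matrixAction_nonneg {A : Matrix (Fin m) (Fin m) ℝ} (hA : A.PosSemidef) (v : Vec m) :
    0 ≤ inner ℝ v (matrixAction m A v) := by
  rw [matrixAction_apply, inner_toEuclideanCLM]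
  simpa using hA.dotProduct_mulVec_nonneg v.ofLp

theorem le_inner_matrixAction {A : Matrix (Fin m) (Fin m) ℝ} {c : ℝ}
    (hA : (A - c • (1 : Matrix (Fin m) (Fin m) ℝ)).PosSemidef) (v : Vec m) :
    c * ‖v‖ ^ 2 ≤ inner ℝ v (matrixAction m A v) := by
  have := inner_matrixAction_nonneg hA v
  rw [map_sub, map_smul, matrixAction_apply 1, map_one, _root_.sub_apply,
    _root_.smul_apply, one_apply_eq_self, inner_sub_right,
    inner_smul_right, real_inner_self_eq_norm_sq] at this
  linarith

theorem inner_matrixAction_le {A : Matrix (Fin m) (Fin m) ℝ} {c : ℝ}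
    (hA : (c • (1 : Matrix (Fin m) (Fin m) ℝ) - A).PosSemidef) (v : Vec m) :
    inner ℝ v (matrixAction m A v) ≤ c * ‖v‖ ^ 2 := by
  have := inner_matrixAction_nonneg hA v
  rw [map_sub, map_smul, matrixAction_apply 1, map_one, _root_.sub_apply,
    _root_.smul_apply, one_apply_eq_self, inner_sub_right,
    inner_smul_right, real_inner_self_eq_norm_sq] at this
  linarith

theorem inner_matrixAction_le_norm (A : Matrix (Fin m) (Fin m) ℝ) (v w : Vec m) :
    inner ℝ v (matrixAction m A w) ≤ ‖A‖ * (‖v‖ * ‖w‖) := by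
  have h1 := real_inner_le_norm v (matrixAction m A w)
  have h2 := (matrixAction m A).le_opNorm w
  rw [norm_matrixAction] at h2
  have := mul_le_mul_of_nonneg_left h2 (norm_nonneg v)
  linarith

theorem inner_matrixAction_transpose (A : Matrix (Fin m) (Fin m) ℝ) (v w : Vec m) :
    inner ℝ v (matrixAction m Aᵀ w) = inner ℝ w (matrixAction m A v) := by
  rw [matrixAction_apply, matrixAction_apply, inner_toEuclideanCLM, inner_toEuclideanCLM,
    mulVec_transpose, dotProduct_comm, dotProduct_mulVec]

/-- Only the symmetric part of Ag contributes to the quadratic form, which is why the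
controllability condition concerns αg + gᵀα alone. -/
theorem inner_matrixAction_mul {A g : Matrix (Fin m) (Fin m) ℝ} (hA : A.IsHermitian) (v : Vec m) :
    2 * inner ℝ v (matrixAction m A (matrixAction m g v)) =
      inner ℝ v (matrixAction m (A * g + gᵀ * A) v) := by
  have hAt : Aᵀ = A := by simpa [IsHermitian] using hA
  have h1 : gᵀ * A = (A * g)ᵀ := by rw [transpose_mul, hAt]
  have h2 : matrixAction m (A * g) v = matrixAction m A (matrixAction m g v) := by
    simp only [matrixAction_apply, map_mul, mul_apply_eq_comp]
  rw [h1, map_add, _root_.add_apply, inner_add_right, inner_matrixAction_transpose,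
    h2]
  ring

end QuadraticForms

/-! ### Pointwise estimates for the control and adaptive laws -/

section Static

variable {r m : ℕ}

namespace Controller

/-- The scalar gain `κ` in `η = κ s`. -/
noncomputable def gain (C : Controller r m) (y : ℝ → Vec m) (x : FullState r m) (θ t : ℝ) : ℝ :=
  C.k + θ * C.core y x t ^ 2 / (C.core y x t * ‖C.s y x t‖ + C.ν t)

theorem eta_eq_gain_smul (C : Controller r m) (y : ℝ → Vec m) (x : FullState r m) (θ t : ℝ) :
    C.eta y x θ t = C.gain y x θ t • C.s y x t := by
  rw [eta, gain, add_smul]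

theorem zetaRate_eq_gain (C : Controller r m) (y : ℝ → Vec m) (x : FullState r m) (θ t : ℝ) :
    C.zetaRate y x θ t = C.σ₁ * (C.gain y x θ t * ‖C.s y x t‖ ^ 2) := by
  rw [zetaRate, eta_eq_gain_smul, inner_smul_right, real_inner_self_eq_norm_sq]

theorem IsAdmissible.core_nonneg {C : Controller r m} (hC : C.IsAdmissible) (y : ℝ → Vec m)
    (x : FullState r m) (t : ℝ) : 0 ≤ C.core y x t := by
  have h1 := hC.φ₁_nonneg (lowState x)
  have h2 := hC.φf_nonneg x
  have h3 := hC.φ₂_nonneg x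
  unfold core
  positivity

theorem IsAdmissible.denom_nonneg {C : Controller r m} (hC : C.IsAdmissible) (y : ℝ → Vec m)
    (x : FullState r m) {t : ℝ} (ht : 0 ≤ t) : 0 ≤ C.core y x t * ‖C.s y x t‖ + C.ν t :=
  add_nonneg (mul_nonneg (hC.core_nonneg y x t) (norm_nonneg _)) (hC.ν_nonneg t ht)

theorem IsAdmissible.k_le_gain {C : Controller r m} (hC : C.IsAdmissible) (y : ℝ → Vec m)
    (x : FullState r m) {θ t : ℝ} (hθ : 0 ≤ θ) (ht : 0 ≤ t) : C.k ≤ C.gain y x θ t :=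
  le_add_of_nonneg_right (div_nonneg (mul_nonneg hθ (sq_nonneg _)) (hC.denom_nonneg y x ht))

theorem IsAdmissible.gain_nonneg {C : Controller r m} (hC : C.IsAdmissible) (y : ℝ → Vec m)
    (x : FullState r m) {θ t : ℝ} (hθ : 0 ≤ θ) (ht : 0 ≤ t) : 0 ≤ C.gain y x θ t :=
  hC.k_pos.le.trans (hC.k_le_gain y x hθ ht)

theorem IsAdmissible.le_zetaRate {C : Controller r m} (hC : C.IsAdmissible) (y : ℝ → Vec m)
    (x : FullState r m) {θ t : ℝ} (hθ : 0 ≤ θ) (ht : 0 ≤ t) :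
    C.σ₁ * C.k * ‖C.s y x t‖ ^ 2 ≤ C.zetaRate y x θ t := by
  rw [zetaRate_eq_gain, mul_assoc]
  have := hC.σ₁_pos.le
  gcongr
  exact hC.k_le_gain y x hθ ht

theorem IsAdmissible.thetaRate_nonneg {C : Controller r m} (hC : C.IsAdmissible) (y : ℝ → Vec m)
    (x : FullState r m) {t : ℝ} (ht : 0 ≤ t) : 0 ≤ C.thetaRate y x t := by
  have := hC.σ₂_pos.le
  exact div_nonneg (by positivity) (hC.denom_nonneg y x ht)

/-- The two sides differ by exactly σ₁k‖s‖². The identity also holds when the denominator vanishes,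
since both quotients are then 0. It ties the growth of θ̂² to that of ζ. -/
theorem IsAdmissible.mul_thetaRate_le {C : Controller r m} (hC : C.IsAdmissible) (y : ℝ → Vec m)
    (x : FullState r m) (θ t : ℝ) :
    C.σ₁ / C.σ₂ * (θ * C.thetaRate y x t) ≤ C.zetaRate y x θ t := by
  have h1 := hC.σ₁_pos
  have h2 := hC.σ₂_pos
  have h3 := hC.k_pos
  have : C.zetaRate y x θ t = C.σ₁ * C.k * ‖C.s y x t‖ ^ 2 +
      C.σ₁ / C.σ₂ * (θ * C.thetaRate y x t) := by
    rw [zetaRate_eq_gain, gain, thetaRate, div_eq_mul_inv, div_eq_mul_inv, div_eq_mul_inv,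
      show C.σ₁ * C.σ₂⁻¹ * (θ * (C.σ₂ * C.core y x t ^ 2 * ‖C.s y x t‖ ^ 2 *
          (C.core y x t * ‖C.s y x t‖ + C.ν t)⁻¹)) =
        C.σ₁ * (C.σ₂⁻¹ * C.σ₂) * (θ * (C.core y x t ^ 2 * ‖C.s y x t‖ ^ 2 *
          (C.core y x t * ‖C.s y x t‖ + C.ν t)⁻¹)) by ring, inv_mul_cancel₀ h2.ne']
    ring
  rw [this]
  have : 0 ≤ C.σ₁ * C.k * ‖C.s y x t‖ ^ 2 := by positivity
  linarith

/-- With a = φ‖s‖, the bound a ≤ a²/(a + ν) + ν follows from a² − ν² ≤ a²; if a + ν = 0, then a = ν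
= 0. It trades the unknown disturbance bound for the adaptation rate plus an integrable remainder.
-/
theorem IsAdmissible.core_mul_norm_le {C : Controller r m} (hC : C.IsAdmissible) (y : ℝ → Vec m)
    (x : FullState r m) {t : ℝ} (ht : 0 ≤ t) :
    C.core y x t * ‖C.s y x t‖ ≤ C.thetaRate y x t / C.σ₂ + C.ν t := by
  have hν := hC.ν_nonneg t ht
  have ha : 0 ≤ C.core y x t * ‖C.s y x t‖ := mul_nonneg (hC.core_nonneg y x t) (norm_nonneg _)
  rw [thetaRate, mul_assoc, ← mul_pow]
  set a := C.core y x t * ‖C.s y x t‖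
  have h1 : C.σ₂ * a ^ 2 / (a + C.ν t) / C.σ₂ = a ^ 2 / (a + C.ν t) := by
    have := hC.σ₂_pos.ne'
    rw [div_div, mul_comm C.σ₂, mul_div_mul_right _ _ this]
  rw [h1]
  rcases (add_nonneg ha hν).eq_or_lt with h0 | h0
  · have : 0 ≤ a ^ 2 / (a + C.ν t) := div_nonneg (sq_nonneg _) (add_nonneg ha hν)
    linarith
  · rw [← sub_le_iff_le_add, le_div_iff₀ h0]
    nlinarith [sq_nonneg (C.ν t)]

theorem IsAdmissible.thetaRate_le {C : Controller r m} (hC : C.IsAdmissible) (y : ℝ → Vec m)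
    (x : FullState r m) {t : ℝ} (ht : 0 ≤ t) :
    C.thetaRate y x t ≤ C.σ₂ * (C.core y x t * ‖C.s y x t‖) := by
  have hν := hC.ν_nonneg t ht
  have h2 := hC.σ₂_pos.le
  have ha : 0 ≤ C.core y x t * ‖C.s y x t‖ := mul_nonneg (hC.core_nonneg y x t) (norm_nonneg _)
  rw [thetaRate, mul_assoc, ← mul_pow, mul_div_assoc]
  gcongr
  exact div_le_of_le_mul₀ (add_nonneg ha hν) ha (by nlinarith)

theorem IsAdmissible.norm_eta_le {C : Controller r m} (hC : C.IsAdmissible) (y : ℝ → Vec m)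
    (x : FullState r m) {θ t : ℝ} (hθ : 0 ≤ θ) (ht : 0 ≤ t) :
    ‖C.eta y x θ t‖ ≤ C.k * ‖C.s y x t‖ + θ * C.core y x t := by
  have hν := hC.ν_nonneg t ht
  have hc := hC.core_nonneg y x t
  have hd := hC.denom_nonneg y x ht
  rw [eta]
  refine (norm_add_le _ _).trans ?_
  rw [norm_smul, norm_smul, Real.norm_of_nonneg hC.k_pos.le,
    Real.norm_of_nonneg (div_nonneg (by positivity) hd), div_mul_eq_mul_div]
  gcongr
  refine div_le_of_le_mul₀ hd (by positivity) ?_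
  have : 0 ≤ θ * C.core y x t * C.ν t := by positivity
  nlinarith

end Controller

theorem IsAdmissibleReference.exists_bound {r : ℕ} {y : ℝ → Vec m}
    (hy : IsAdmissibleReference r y) :
    ∃ M, 0 ≤ M ∧ ∀ i ≤ r + 1, ∀ t, 0 ≤ t → ‖refDeriv y i t‖ ≤ M := by
  choose! M hM using hy.bounded
  refine ⟨∑ i ∈ Finset.range (r + 2), |M i|, Finset.sum_nonneg fun i _ => abs_nonneg _,
    fun i hi t ht => (hM i hi t ht).trans ((le_abs_self _).trans ?_)⟩
  exact Finset.single_le_sum (f := fun i => |M i|) (fun i _ => abs_nonneg _)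
    (Finset.mem_range.2 (by omega))

theorem norm_lowState_le {x : FullState r m} {R : ℝ} (hx : ∀ i, ‖x i‖ ≤ R) :
    ‖lowState x‖ ≤ R :=
  (pi_norm_le_iff_of_nonneg ((norm_nonneg _).trans (hx 0))).2 fun i => hx i.castSucc

theorem norm_fullState_le {x : FullState r m} {R : ℝ} (hx : ∀ i, ‖x i‖ ≤ R) : ‖x‖ ≤ R :=
  (pi_norm_le_iff_of_nonempty _).2 hx

/-- On bounded sets of states, the errors, `s`, `Φ`, `φ` and the bounding functions are bounded. -/
theorem exists_static_bound {C : Controller r m} (hC : C.IsAdmissible) {y : ℝ → Vec m}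
    (hy : IsAdmissibleReference r y) (R : ℝ) :
    ∃ S, 0 ≤ S ∧ ∀ (x : FullState r m) (t : ℝ), 0 ≤ t → (∀ i, ‖x i‖ ≤ R) →
      (∀ i, ‖errState y x t i‖ ≤ S) ∧ ‖C.s y x t‖ ≤ S ∧ ‖C.Phi y x t‖ ≤ S ∧
        C.core y x t ≤ S ∧ C.φ₁ (lowState x) ≤ S ∧ C.φf x ≤ S := by
  obtain ⟨M, hM0, hM⟩ := hy.exists_bound
  obtain ⟨Bf, hBf⟩ := hC.φf_bounded R
  obtain ⟨B₁, hB₁⟩ := hC.φ₁_bounded R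
  obtain ⟨B₂, hB₂⟩ := hC.φ₂_bounded R
  set Λ := ∑ i : Fin r, |C.lam i| with hΛ
  have hΛ0 : 0 ≤ Λ := Finset.sum_nonneg fun i _ => abs_nonneg _
  set E := |R| + M with hE
  have hE0 : 0 ≤ E := by positivity
  set Q := |B₁| * (Λ * E + |Bf| + 1) + 1 / 2 * |B₂| * (Λ * E + E) with hQ
  have hQ0 : 0 ≤ Q := by positivity
  refine ⟨E + Λ * E + Q + |B₁| + |Bf|, by positivity, fun x t ht hx => ?_⟩
  have hΛE : 0 ≤ Λ * E := by positivity
  have b1 := abs_nonneg B₁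
  have bf := abs_nonneg Bf
  have he : ∀ i, ‖errState y x t i‖ ≤ E := fun i =>
    (norm_sub_le _ _).trans (add_le_add ((hx i).trans (le_abs_self R))
      (hM i (by have := i.2; omega) t ht))
  have hsum : ∀ v : Fin r → Vec m, (∀ i, ‖v i‖ ≤ E) → ‖∑ i, C.lam i • v i‖ ≤ Λ * E := by
    intro v hv
    rw [hΛ, Finset.sum_mul]
    refine (norm_sum_le _ _).trans (Finset.sum_le_sum fun i _ => ?_)
    rw [norm_smul, Real.norm_eq_abs]
    gcongr
    exact hv i
  have hs : ‖C.s y x t‖ ≤ Λ * E + E :=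
    (norm_add_le _ _).trans (add_le_add (hsum _ fun i => he _) (he _))
  have hΦ : ‖C.Phi y x t‖ ≤ Λ * E := hsum _ fun i => he _
  have h1 : C.φ₁ (lowState x) ≤ |B₁| := (hB₁ _ (norm_lowState_le hx)).trans (le_abs_self _)
  have hf : C.φf x ≤ |Bf| := (hBf _ (norm_fullState_le hx)).trans (le_abs_self _)
  have h2 : C.φ₂ x ≤ |B₂| := (hB₂ _ (norm_fullState_le hx)).trans (le_abs_self _)
  have hcore : C.core y x t ≤ Q := by
    have := hC.φf_nonneg x
    have := hC.φ₂_nonneg x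
    unfold Controller.core
    rw [hQ]
    gcongr
  exact ⟨fun i => (he i).trans (by linarith), by linarith, by linarith, by linarith, by linarith,
    by linarith⟩

end Static

/-! ### Closed-loop dynamics and the Lyapunov derivative -/

section Dynamics

variable {r m : ℕ} {P : Plant r m} {C : Controller r m} {y : ℝ → Vec m} {t₀ : ℝ} {J : Set ℝ}
  {x : ℝ → FullState r m} {ζ θ : ℝ → ℝ}

namespace IsClosedLoopSolution

theorem nonneg_of_mem (h : IsClosedLoopSolution P C y t₀ J x ζ θ) {t : ℝ} (ht : t ∈ J) : 0 ≤ t :=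
  h.start_nonneg.trans (h.isLeast.2 ht)

theorem restrict (h : IsClosedLoopSolution P C y t₀ J x ζ θ) {T : ℝ} (hT : T ∈ J) :
    IsClosedLoopSolution P C y t₀ (Icc t₀ T) x ζ θ := by
  have hsub : Icc t₀ T ⊆ J := h.ordConnected.out h.isLeast.1 hT
  exact
  { start_nonneg := h.start_nonneg
    isLeast := isLeast_Icc (h.isLeast.2 hT)
    ordConnected := ordConnected_Icc
    zeta_nonneg := h.zeta_nonneg
    theta_nonneg := h.theta_nonneg
    chain := fun t ht i => (h.chain t (hsub ht) i).mono hsub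
    last := fun t ht => (h.last t (hsub ht)).mono hsub
    zeta := fun t ht => (h.zeta t (hsub ht)).mono hsub
    theta := fun t ht => (h.theta t (hsub ht)).mono hsub }

theorem theta_monotoneOn (hC : C.IsAdmissible) (h : IsClosedLoopSolution P C y t₀ J x ζ θ) :
    MonotoneOn θ J :=
  monotoneOn_of_hasDerivWithinAt_self h.ordConnected h.theta
    fun _ ht => hC.thetaRate_nonneg y _ (h.nonneg_of_mem ht)

theorem theta_nonneg_of_mem (hC : C.IsAdmissible) (h : IsClosedLoopSolution P C y t₀ J x ζ θ)
    {t : ℝ} (ht : t ∈ J) : 0 ≤ θ t :=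
  h.theta_nonneg.trans (h.theta_monotoneOn hC h.isLeast.1 ht (h.isLeast.2 ht))

theorem zeta_monotoneOn (hC : C.IsAdmissible) (h : IsClosedLoopSolution P C y t₀ J x ζ θ) :
    MonotoneOn ζ J :=
  monotoneOn_of_hasDerivWithinAt_self h.ordConnected h.zeta fun t ht =>
    le_trans (by have := hC.σ₁_pos; have := hC.k_pos; positivity)
      (hC.le_zetaRate y (x t) (h.theta_nonneg_of_mem hC ht) (h.nonneg_of_mem ht))

theorem zeta_nonneg_of_mem (hC : C.IsAdmissible) (h : IsClosedLoopSolution P C y t₀ J x ζ θ)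
    {t : ℝ} (ht : t ∈ J) : 0 ≤ ζ t :=
  h.zeta_nonneg.trans (h.zeta_monotoneOn hC h.isLeast.1 ht (h.isLeast.2 ht))

/-- Integrating 2θ̂θ̂' ≤ (2σ₂/σ₁) ζ' eliminates θ̂ as an independent unknown. -/
theorem theta_sq_le (hC : C.IsAdmissible) (h : IsClosedLoopSolution P C y t₀ J x ζ θ)
    {t : ℝ} (ht : t ∈ J) :
    θ t ^ 2 ≤ θ t₀ ^ 2 + 2 * C.σ₂ / C.σ₁ * (ζ t - ζ t₀) := by
  have h1 := hC.σ₁_pos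
  have h2 := hC.σ₂_pos
  have hm : MonotoneOn (fun τ => 2 * C.σ₂ / C.σ₁ * ζ τ - θ τ ^ 2) J :=
    monotoneOn_of_hasDerivWithinAt_self h.ordConnected
      (fun t ht => ((h.zeta t ht).const_mul _).sub ((h.theta t ht).pow 2))
      (fun t ht => by
        have h3 := hC.mul_thetaRate_le y (x t) (θ t) t
        have h4 : 2 * C.σ₂ / C.σ₁ * (C.σ₁ / C.σ₂ * (θ t * C.thetaRate y (x t) t)) ≤
          2 * C.σ₂ / C.σ₁ * C.zetaRate y (x t) (θ t) t := by gcongr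
        have h5 : 2 * C.σ₂ / C.σ₁ * (C.σ₁ / C.σ₂ * (θ t * C.thetaRate y (x t) t)) =
          2 * (θ t * C.thetaRate y (x t) t) := by field_simp
        simp only [Nat.cast_ofNat, Nat.add_one_sub_one, pow_one]
        linarith)
  have := hm h.isLeast.1 ht (h.isLeast.2 ht)
  simp only at this
  linarith

theorem refDeriv_hasDerivWithinAt (hy : IsAdmissibleReference r y) {i : ℕ} (hi : i ≤ r) {t : ℝ}
    (ht : 0 ≤ t) : HasDerivWithinAt (refDeriv y i) (refDeriv y (i + 1) t) (Ici 0) t := by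
  have := (hy.differentiableOn i hi t ht).hasDerivWithinAt
  rwa [show derivWithin (refDeriv y i) (Ici 0) t = refDeriv y (i + 1) t by
    rw [refDeriv, iteratedDerivWithin_succ]; rfl] at this

theorem subset_Ici (h : IsClosedLoopSolution P C y t₀ J x ζ θ) : J ⊆ Ici 0 :=
  fun _ ht => h.nonneg_of_mem ht

theorem errState_castSucc (hy : IsAdmissibleReference r y)
    (h : IsClosedLoopSolution P C y t₀ J x ζ θ) {t : ℝ} (ht : t ∈ J) (i : Fin r) :
    HasDerivWithinAt (fun τ => errState y (x τ) τ i.castSucc) (errState y (x t) t i.succ) J t :=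
  (h.chain t ht i).sub
    ((refDeriv_hasDerivWithinAt hy (by simp) (h.nonneg_of_mem ht)).mono h.subset_Ici)

theorem s_hasDerivWithinAt (hy : IsAdmissibleReference r y)
    (h : IsClosedLoopSolution P C y t₀ J x ζ θ) {t : ℝ} (ht : t ∈ J) :
    HasDerivWithinAt (fun τ => C.s y (x τ) τ)
      (C.Phi y (x t) t + (accel P C y (x t) (ζ t) (θ t) t - refDeriv y (r + 1) t)) J t :=
  (HasDerivWithinAt.fun_sum fun i _ => (h.errState_castSucc hy ht i).const_smul (C.lam i)).add
    ((h.last t ht).sub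
      ((refDeriv_hasDerivWithinAt hy le_rfl (h.nonneg_of_mem ht)).mono h.subset_Ici))

end IsClosedLoopSolution

/-- The Lyapunov function `sᵀ α s`. -/
noncomputable def lyapunov (C : Controller r m) (y : ℝ → Vec m)
    (α : (Fin r → Vec m) → ℝ → Matrix (Fin m) (Fin m) ℝ) (x : FullState r m) (t : ℝ) : ℝ :=
  inner ℝ (C.s y x t) (matrixAction m (α (lowState x) t) (C.s y x t))

theorem lyapunov_nonneg {α : (Fin r → Vec m) → ℝ → Matrix (Fin m) (Fin m) ℝ} {lo hi : ℝ}
    (hα : IsAuxiliaryMatrix P α lo hi) (x : FullState r m) {t : ℝ} (ht : 0 ≤ t) :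
    0 ≤ lyapunov C y α x t :=
  inner_matrixAction_nonneg (hα.posDef _ t ht).posSemidef _

/-- Gain inequality for the indefinite term of the Lyapunov derivative. -/
theorem mul_le_gain {lo hi q η N : ℝ} (h1 : lo * N ≤ q) (h2 : q ≤ hi * N) :
    η * q ≤ (hi * max 0 η - lo * max 0 (-η)) * N := by
  rcases le_total 0 η with h | h
  · rw [max_eq_right h, max_eq_left (by linarith)]
    nlinarith
  · rw [max_eq_left h, max_eq_right (by linarith)]
    nlinarith

/-- The function `h` is `C.h` or its negative, according to the sign of αg + gᵀα. The gain term is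
stated through ζ' because it is then the time derivative of a function of ζ alone. -/
theorem exists_lyapunov_deriv_le {α : (Fin r → Vec m) → ℝ → Matrix (Fin m) (Fin m) ℝ}
    {lo hi L : ℝ} (hC : C.IsAdmissible) (hy : IsAdmissibleReference r y)
    (hα : IsAuxiliaryMatrix P α lo hi) (hgrowth : GrowthBounds P C α)
    (hN : IsBLNussbaum L C.h) :
    ∃ (h : ℝ → ℝ) (c : ℝ), IsBLNussbaum L h ∧ 0 ≤ c ∧
      ∀ (t₀ : ℝ) (J : Set ℝ) (x : ℝ → FullState r m) (ζ θ : ℝ → ℝ),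
        IsClosedLoopSolution P C y t₀ J x ζ θ → ∀ t ∈ J, ∃ V',
          HasDerivWithinAt (fun τ => lyapunov C y α (x τ) τ) V' J t ∧
          V' ≤ c * (C.core y (x t) t * ‖C.s y (x t) t‖) +
            (hi * max 0 (h (ζ t)) - lo * max 0 (-h (ζ t))) / C.σ₁ *
              C.zetaRate y (x t) (θ t) t := by
  obtain ⟨af, a₁, a₂, haf, ha₁, ha₂, hf, hA, hA'⟩ := hgrowth
  obtain ⟨M, hM0, hM⟩ := hy.exists_bound
  obtain ⟨h, hNh, hh⟩ : ∃ h : ℝ → ℝ, IsBLNussbaum L h ∧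
      ∀ (x : FullState r m) (t z κ : ℝ) (v : Vec m), 0 ≤ t → 0 ≤ κ →
        2 * inner ℝ v (matrixAction m (α (lowState x) t)
          (matrixAction m (P.g x t) (C.h z • κ • v))) ≤
        (hi * max 0 (h z) - lo * max 0 (-h z)) * (κ * ‖v‖ ^ 2) := by
    have key : ∀ (x : FullState r m) (t z κ : ℝ) (v : Vec m), 0 ≤ t →
        2 * inner ℝ v (matrixAction m (α (lowState x) t)
          (matrixAction m (P.g x t) (C.h z • κ • v))) =
        C.h z * (κ * inner ℝ v (matrixAction m (α (lowState x) t * P.g x t +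
          (P.g x t).transpose * α (lowState x) t) v)) := by
      intro x t z κ v ht
      rw [← inner_matrixAction_mul (hα.posDef _ t ht).isHermitian]
      simp only [map_smul, inner_smul_right]
      ring
    rcases hα.definite with hd | hd
    · refine ⟨C.h, hN, fun x t z κ v ht hκ => ?_⟩
      rw [key x t z κ v ht]
      have h1 := le_inner_matrixAction (hd x t ht).1 v
      have h2 := inner_matrixAction_le (hd x t ht).2 v
      refine mul_le_gain ?_ ?_
      · nlinarith
      · nlinarith
    -- The product of `C.h` and the quadratic form is unchanged when both are negated, which reduces
    -- this case to the positive one.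
    · refine ⟨fun z => -C.h z, hN.neg, fun x t z κ v ht hκ => ?_⟩
      rw [key x t z κ v ht]
      have h1 := le_inner_matrixAction (hd x t ht).1 v
      have h2 := inner_matrixAction_le (hd x t ht).2 v
      rw [← neg_mul_neg]
      refine mul_le_gain ?_ ?_
      · nlinarith
      · nlinarith
  refine ⟨h, 2 * a₁ * (1 + af + M) + 2 * a₂, hNh, by positivity, ?_⟩
  intro t₀ J x ζ θ hsol t ht
  have ht0 := hsol.nonneg_of_mem ht
  have hs := hsol.s_hasDerivWithinAt hy ht
  have hpath : HasDerivWithinAt (fun τ => (lowState (x τ), τ)) (highState (x t), (1 : ℝ)) J t :=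
    HasDerivWithinAt.prodMk (hasDerivWithinAt_pi.2 fun i => hsol.chain t ht i)
      (hasDerivWithinAt_id t J)
  have hαd : HasDerivWithinAt (fun τ => α (lowState (x τ)) τ) (totalDeriv α (x t) t) J t :=
    HasFDerivWithinAt.comp_hasDerivWithinAt (f := fun τ => (lowState (x τ), τ)) t
      (hα.differentiableOn (lowState (x t), t) ⟨mem_univ _, ht0⟩).hasFDerivWithinAt hpath
      fun τ hτ => ⟨mem_univ _, hsol.nonneg_of_mem hτ⟩
  have hAd := (matrixAction m).hasFDerivAt.comp_hasDerivWithinAt t hαd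
  have hV := hs.inner ℝ (hAd.clm_apply hs)
  refine ⟨_, hV, ?_⟩
  set S := C.s y (x t) t with hS
  set A := α (lowState (x t)) t with hAdef
  set D := totalDeriv α (x t) t
  set Φ := C.Phi y (x t) t with hΦ
  set κ := C.gain y (x t) (θ t) t with hκdef
  have hκ : 0 ≤ κ := hC.gain_nonneg y _ (hsol.theta_nonneg_of_mem hC ht) ht0
  have hsym : ∀ v w, inner ℝ v (matrixAction m A w) = inner ℝ w (matrixAction m A v) := by
    intro v w
    have hAt : A.transpose = A := by simpa [Matrix.IsHermitian] using (hα.posDef _ t ht0).isHermitian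
    rw [← inner_matrixAction_transpose, hAt]
  set b := Φ + (P.f (x t) + P.d (x t) t) - refDeriv y (r + 1) t with hb
  have hsplit : Φ + (accel P C y (x t) (ζ t) (θ t) t - refDeriv y (r + 1) t) =
      b + matrixAction m (P.g (x t) t) (C.h (ζ t) • κ • S) := by
    rw [accel, Controller.control, Controller.eta_eq_gain_smul, matrixAction_apply, hb]
    abel
  rw [hsplit]
  set w := matrixAction m (P.g (x t) t) (C.h (ζ t) • κ • S) with hw
  have hgain := hh (x t) t (ζ t) κ S ht0 hκ
  have hD := inner_matrixAction_le_norm D S S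
  have hbA := inner_matrixAction_le_norm A S b
  have hD' : ‖D‖ ≤ a₂ * C.φ₂ (x t) := hA' (x t) t ht0
  have hA1 : ‖A‖ ≤ a₁ * C.φ₁ (lowState (x t)) := hA _ t ht0
  have p1 := hC.φ₁_nonneg (lowState (x t))
  have pf := hC.φf_nonneg (x t)
  have p2 := hC.φ₂_nonneg (x t)
  -- The summand 1 in φ is there to absorb the bound `M` on the n-th reference derivative.
  have hbn : ‖b‖ ≤ (1 + af + M) * (‖Φ‖ + C.φf (x t) + 1) := by
    have h1 : ‖b‖ ≤ ‖Φ‖ + af * C.φf (x t) + M :=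
      (norm_sub_le _ _).trans (add_le_add ((norm_add_le _ _).trans
        (add_le_add le_rfl (hf _ t ht0))) (hM _ le_rfl t ht0))
    have := norm_nonneg Φ
    nlinarith [mul_nonneg haf.le (norm_nonneg Φ), mul_nonneg hM0 (norm_nonneg Φ),
      mul_nonneg hM0 pf]
  have hb1 : ‖A‖ * (‖S‖ * ‖b‖) ≤ a₁ * C.φ₁ (lowState (x t)) *
      (‖S‖ * ((1 + af + M) * (‖Φ‖ + C.φf (x t) + 1))) := by gcongr
  have hD1 : ‖D‖ * (‖S‖ * ‖S‖) ≤ a₂ * C.φ₂ (x t) * (‖S‖ * ‖S‖) := by gcongr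
  have hζ : (hi * max 0 (h (ζ t)) - lo * max 0 (-h (ζ t))) / C.σ₁ *
      C.zetaRate y (x t) (θ t) t =
      (hi * max 0 (h (ζ t)) - lo * max 0 (-h (ζ t))) * (κ * ‖S‖ ^ 2) := by
    rw [Controller.zetaRate_eq_gain, ← mul_assoc, div_mul_cancel₀ _ hC.σ₁_pos.ne']
  have hcore : C.core y (x t) t = C.φ₁ (lowState (x t)) * (‖Φ‖ + C.φf (x t) + 1) +
    1 / 2 * C.φ₂ (x t) * ‖S‖ := rfl
  rw [hζ, hcore]
  simp only [Function.comp_apply, ← hAdef]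
  rw [hsym (b + w) S]
  simp only [map_add, inner_add_right]
  -- Of the four products in c φ‖s‖, two dominate the terms of V'. These are the other two, which
  -- are nonnegative and discarded. The weight 2a₂ compensates for the factor ½ in φ.
  have q1 : 0 ≤ 2 * a₁ * (1 + af + M) * (1 / 2 * C.φ₂ (x t) * ‖S‖ * ‖S‖) := by positivity
  have q2 : 0 ≤ 2 * a₂ * (C.φ₁ (lowState (x t)) * (‖Φ‖ + C.φf (x t) + 1) * ‖S‖) := by
    have := norm_nonneg Φ
    positivity
  linarith

end Dynamics

/-! ### Boundedness of the adaptive parameters -/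

section Bounds

variable {r m : ℕ} {P : Plant r m} {C : Controller r m} {y : ℝ → Vec m}
  {α : (Fin r → Vec m) → ℝ → Matrix (Fin m) (Fin m) ℝ} {lo hi L : ℝ}

theorem Controller.IsAdmissible.exists_integral_bound (hC : C.IsAdmissible) :
    ∃ M, 0 ≤ M ∧ ∀ a b, 0 ≤ a → a ≤ b → ∫ τ in a..b, C.ν τ ≤ M := by
  obtain ⟨M, hM⟩ := hC.ν_bounded
  refine ⟨|M|, abs_nonneg M, fun a b ha hab => le_trans ?_ ((hM b (ha.trans hab)).trans (le_abs_self M))⟩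
  have h1 : IntervalIntegrable C.ν MeasureTheory.volume a b :=
    (hC.ν_integrable a ha).symm.trans (hC.ν_integrable b (ha.trans hab))
  rw [← intervalIntegral.integral_add_adjacent_intervals (hC.ν_integrable a ha) h1]
  have := intervalIntegral.integral_nonneg (μ := MeasureTheory.volume) ha
    fun u hu => hC.ν_nonneg u hu.1
  linarith

/-- The Lyapunov function is bounded by an affine function of `ζ` plus the Nussbaum gain. -/
theorem exists_lyapunov_le (hC : C.IsAdmissible) (hy : IsAdmissibleReference r y)
    (hα : IsAuxiliaryMatrix P α lo hi) (hgrowth : GrowthBounds P C α)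
    (hN : IsBLNussbaum L C.h) (R : ℝ) :
    ∃ (h : ℝ → ℝ) (c₀ c₁ : ℝ), IsBLNussbaum L h ∧
      ∀ (t₀ : ℝ) (J : Set ℝ) (x : ℝ → FullState r m) (ζ θ : ℝ → ℝ),
        IsClosedLoopSolution P C y t₀ J x ζ θ → (∀ i, ‖x t₀ i‖ ≤ R) → ζ t₀ ≤ R → θ t₀ ≤ R →
        ∀ t ∈ J, lyapunov C y α (x t) t ≤ c₀ + c₁ * ζ t + nussbaumGain hi lo h (ζ t) / C.σ₁ := by
  obtain ⟨h, c, hNh, hc, hder⟩ := exists_lyapunov_deriv_le hC hy hα hgrowth hN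
  obtain ⟨-, a₁, -, -, ha₁, -, -, hA, -⟩ := hgrowth
  obtain ⟨S, hS0, hS⟩ := exists_static_bound hC hy R
  obtain ⟨M, hM0, hM⟩ := hC.exists_integral_bound
  have hσ₁ := hC.σ₁_pos
  have hσ₂ := hC.σ₂_pos
  have hcont := hNh.contDiffOn.continuousOn
  -- The initial value of ζ ranges over [0, R], so the initial gain has to be bounded uniformly
  -- there.
  obtain ⟨H, hH⟩ : ∃ H, ∀ z ∈ Icc 0 R, -nussbaumGain hi lo h z ≤ H := by
    obtain ⟨H, hH⟩ := (isCompact_Icc (a := (0 : ℝ)) (b := R)).bddAbove_image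
      (f := fun z => -nussbaumGain hi lo h z) fun z hz =>
        (hasDerivAt_nussbaumGain hcont hi lo hz.1).continuousAt.continuousWithinAt.neg
    exact ⟨H, fun z hz => hH ⟨z, hz, rfl⟩⟩
  refine ⟨h, a₁ * S * (S * S) + c / C.σ₂ * (1 + R ^ 2) + H / C.σ₁ + c * M,
    c / C.σ₂ * (2 * C.σ₂ / C.σ₁), hNh, ?_⟩
  intro t₀ J x ζ θ hsol hx hζ₀ hθ₀ t ht
  have htt : t₀ ≤ t := hsol.isLeast.2 ht
  -- On a compact interval, derivatives within it are genuine two-sided derivatives at interior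
  -- points.
  have hsol' := hsol.restrict ht
  choose! V' hV hV' using hder t₀ (Icc t₀ t) x ζ θ hsol'
  have hW : ∀ τ ∈ Icc t₀ t, HasDerivWithinAt
      (fun τ => lyapunov C y α (x τ) τ - c / C.σ₂ * θ τ - nussbaumGain hi lo h (ζ τ) / C.σ₁)
      (V' τ - c / C.σ₂ * C.thetaRate y (x τ) τ -
        (hi * max 0 (h (ζ τ)) - lo * max 0 (-h (ζ τ))) * C.zetaRate y (x τ) (θ τ) τ / C.σ₁)
      (Icc t₀ t) τ := fun τ hτ =>
    ((hV τ hτ).sub ((hsol'.theta τ hτ).const_mul _)).sub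
      (((hasDerivAt_nussbaumGain hcont hi lo (hsol'.zeta_nonneg_of_mem hC hτ)).comp_hasDerivWithinAt
        τ (hsol'.zeta τ hτ)).div_const _)
  have hint : IntervalIntegrable (fun τ => c * C.ν τ) MeasureTheory.volume t₀ t :=
    ((hC.ν_integrable t₀ hsol.start_nonneg).symm.trans
      (hC.ν_integrable t (hsol.nonneg_of_mem ht))).const_mul c
  -- The comparison W' ≤ cν requires integrability of ν only, not of W'.
  have key := intervalIntegral.sub_le_integral_of_hasDeriv_right_of_le htt
    (φ := fun τ => c * C.ν τ) (fun τ hτ => (hW τ hτ).continuousWithinAt)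
    (fun τ hτ => ((hW τ (Ioo_subset_Icc_self hτ)).hasDerivAt
      (Icc_mem_nhds hτ.1 hτ.2)).hasDerivWithinAt)
    ((intervalIntegrable_iff_integrableOn_Icc_of_le htt).1 hint) (fun τ hτ => by
      have hτ' := Ioo_subset_Icc_self hτ
      have h1 := hV' τ hτ'
      have h2 := mul_le_mul_of_nonneg_left
        (hC.core_mul_norm_le y (x τ) (hsol'.nonneg_of_mem hτ')) hc
      rw [div_mul_eq_mul_div] at h1
      have h3 : c * (C.thetaRate y (x τ) τ / C.σ₂ + C.ν τ) =
        c / C.σ₂ * C.thetaRate y (x τ) τ + c * C.ν τ := by ring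
      linarith)
  simp only [intervalIntegral.integral_const_mul] at key
  have hν := mul_le_mul_of_nonneg_left (hM t₀ t hsol.start_nonneg htt) hc
  have hV0 : lyapunov C y α (x t₀) t₀ ≤ a₁ * S * (S * S) := by
    obtain ⟨-, hs, -, -, h1, -⟩ := hS (x t₀) t₀ hsol.start_nonneg hx
    refine (inner_matrixAction_le_norm _ _ _).trans ?_
    have h2 : ‖α (lowState (x t₀)) t₀‖ ≤ a₁ * S :=
      (hA _ _ hsol.start_nonneg).trans (by gcongr)
    gcongr
  -- The estimate θ̂ ≤ 1 + θ̂², crude but sufficient, makes the bound affine in ζ.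
  have hθ : θ t ≤ 1 + R ^ 2 + 2 * C.σ₂ / C.σ₁ * ζ t := by
    have h1 := hsol.theta_sq_le hC ht
    have h2 : θ t₀ ^ 2 ≤ R ^ 2 := pow_le_pow_left₀ hsol.theta_nonneg hθ₀ 2
    have h3 : 0 ≤ 2 * C.σ₂ / C.σ₁ * ζ t₀ := mul_nonneg (by positivity) hsol.zeta_nonneg
    nlinarith [sq_nonneg (θ t - 1)]
  have hθ' : c / C.σ₂ * θ t ≤ c / C.σ₂ * (1 + R ^ 2 + 2 * C.σ₂ / C.σ₁ * ζ t) := by gcongr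
  have hH' : -nussbaumGain hi lo h (ζ t₀) / C.σ₁ ≤ H / C.σ₁ := by
    gcongr
    exact hH _ ⟨hsol.zeta_nonneg, hζ₀⟩
  have hθ0 : 0 ≤ c / C.σ₂ * θ t₀ := mul_nonneg (by positivity) hsol.theta_nonneg
  rw [neg_div] at hH'
  linarith

/-- The adaptive parameters and the Lyapunov function are uniformly bounded. -/
theorem exists_parameter_bound (hC : C.IsAdmissible) (hy : IsAdmissibleReference r y)
    (hlo : 0 < lo) (hα : IsAuxiliaryMatrix P α lo hi) (hgrowth : GrowthBounds P C α)
    (hL : hi / lo < L) (hN : IsBLNussbaum L C.h) (R : ℝ) :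
    ∃ Z, 0 ≤ Z ∧ ∀ (t₀ : ℝ) (J : Set ℝ) (x : ℝ → FullState r m) (ζ θ : ℝ → ℝ),
        IsClosedLoopSolution P C y t₀ J x ζ θ → (∀ i, ‖x t₀ i‖ ≤ R) → ζ t₀ ≤ R → θ t₀ ≤ R →
        ∀ t ∈ J, ζ t ≤ Z ∧ θ t ≤ Z ∧ lyapunov C y α (x t) t ≤ Z := by
  obtain ⟨h, c₀, c₁, hNh, hV⟩ := exists_lyapunov_le hC hy hα hgrowth hN R
  have hσ₁ := hC.σ₁_pos
  have hσ₂ := hC.σ₂_pos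
  -- At this z the upper bound for V is negative. It depends on `R` and the data but not on the
  -- solution, whence the uniformity.
  obtain ⟨z, hRz, hz, hneg⟩ := hNh.exists_nussbaumGain_lt hlo hL (-(C.σ₁ * c₀)) (-(C.σ₁ * c₁)) R
  obtain ⟨G, hG⟩ : ∃ G, ∀ u ∈ Icc 0 z, c₀ + c₁ * u + nussbaumGain hi lo h u / C.σ₁ ≤ G := by
    obtain ⟨G, hG⟩ := (isCompact_Icc (a := (0 : ℝ)) (b := z)).bddAbove_image
      (f := fun u => c₀ + c₁ * u + nussbaumGain hi lo h u / C.σ₁) fun u hu =>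
        (by fun_prop : ContinuousWithinAt (fun u => c₀ + c₁ * u) (Icc 0 z) u).add
          ((hasDerivAt_nussbaumGain hNh.contDiffOn.continuousOn hi lo
            hu.1).continuousAt.continuousWithinAt.div_const _)
    exact ⟨G, fun u hu => hG ⟨u, hu, rfl⟩⟩
  set T := R ^ 2 + 2 * C.σ₂ / C.σ₁ * z
  have hT : 0 ≤ T := by positivity
  refine ⟨z + (1 + T) + |G|, by positivity, ?_⟩
  intro t₀ J x ζ θ hsol hx hζ₀ hθ₀ t ht
  -- Reaching z would force V < 0. Since ζ starts at or below z, continuity keeps it below.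
  have hnever : ∀ τ ∈ J, ζ τ ≠ z := by
    intro τ hτ h1
    have h2 := hV t₀ J x ζ θ hsol hx hζ₀ hθ₀ τ hτ
    have h3 := lyapunov_nonneg (C := C) (y := y) hα (x τ) (hsol.nonneg_of_mem hτ)
    rw [h1] at h2
    have h4 : 0 ≤ C.σ₁ * (c₀ + c₁ * z + nussbaumGain hi lo h z / C.σ₁) :=
      mul_nonneg hσ₁.le (h3.trans h2)
    rw [mul_add, mul_div_cancel₀ _ hσ₁.ne'] at h4
    linarith
  have hζ : ζ t < z := by
    by_contra! hge
    have htt : t₀ ≤ t := hsol.isLeast.2 ht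
    have hsub : Icc t₀ t ⊆ J := hsol.ordConnected.out hsol.isLeast.1 ht
    obtain ⟨τ, hτ, h1⟩ := intermediate_value_Icc htt
      (fun τ hτ => ((hsol.zeta τ (hsub hτ)).mono hsub).continuousWithinAt)
      (show z ∈ Icc (ζ t₀) (ζ t) from ⟨hζ₀.trans hRz, hge⟩)
    exact hnever τ (hsub hτ) h1
  have hθ : θ t ≤ 1 + T := by
    have h1 := hsol.theta_sq_le hC ht
    have h2 : θ t₀ ^ 2 ≤ R ^ 2 := pow_le_pow_left₀ hsol.theta_nonneg hθ₀ 2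
    have h3 : 2 * C.σ₂ / C.σ₁ * (ζ t - ζ t₀) ≤ 2 * C.σ₂ / C.σ₁ * z := by
      gcongr
      linarith [hsol.zeta_nonneg]
    have h4 : θ t ^ 2 ≤ T := h1.trans (add_le_add h2 h3)
    nlinarith [sq_nonneg (θ t - 1)]
  have hVG := (hV t₀ J x ζ θ hsol hx hζ₀ hθ₀ t ht).trans
    (hG _ ⟨hsol.zeta_nonneg_of_mem hC ht, hζ.le⟩)
  have := le_abs_self G
  have := abs_nonneg G
  exact ⟨by linarith, by linarith, by linarith⟩

end Bounds

/-! ### The filtered error as the Hurwitz operator applied to the error jet -/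

section Filter

open Polynomial

variable {r m : ℕ} {P : Plant r m} {C : Controller r m} {y : ℝ → Vec m}

/-- The filter polynomial `zⁿ⁻¹ + λₙ₋₁ zⁿ⁻² + ⋯ + λ₁`. -/
noncomputable def Controller.filterPoly (C : Controller r m) : ℂ[X] :=
  X ^ r + ∑ i : Fin r, Polynomial.C (C.lam i : ℂ) * X ^ (i : ℕ)

theorem Controller.exists_filter_roots (hC : C.IsAdmissible) :
    ∃ Z : Multiset ℂ, rootPoly Z = C.filterPoly ∧ Z.card = r ∧ ∀ z ∈ Z, z.re < 0 := by
  have hdeg : (∑ i : Fin r, Polynomial.C (C.lam i : ℂ) * X ^ (i : ℕ)).degree < ((r : ℕ) : WithBot ℕ) :=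
    degree_sum_fin_lt _
  have hmonic : C.filterPoly.Monic := monic_X_pow_add hdeg
  have hsplit := IsAlgClosed.splits C.filterPoly
  have hroot : rootPoly C.filterPoly.roots = C.filterPoly :=
    (hsplit.eq_prod_roots_of_monic hmonic).symm
  refine ⟨C.filterPoly.roots, hroot, ?_, fun z hz => hC.hurwitz z ?_⟩
  · rw [← rootPoly_natDegree, hroot]
    exact natDegree_eq_of_degree_eq_some (by
      rw [filterPoly, degree_add_eq_left_of_degree_lt (by rwa [degree_X_pow]), degree_X_pow])
  · have := (mem_roots'.1 hz).2
    simpa [filterPoly, IsRoot, eval_finsetSum] using this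

/-- The complexified jet of the `c`-th component of the tracking error. -/
noncomputable def errJet (y : ℝ → Vec m) (x : ℝ → FullState r m) (c : Fin m) (i : ℕ) (t : ℝ) : ℂ :=
  if hi : i < r + 1 then ((errState y (x t) t ⟨i, hi⟩ c : ℝ) : ℂ) else 0

theorem jetEval_filterPoly (C : Controller r m) (y : ℝ → Vec m) (x : ℝ → FullState r m)
    (c : Fin m) (t : ℝ) :
    jetEval C.filterPoly (errJet y x c) t = ((C.s y (x t) t c : ℝ) : ℂ) := by
  have hdeg : (∑ i : Fin r, Polynomial.C (C.lam i : ℂ) * X ^ (i : ℕ)).degree < ((r : ℕ) : WithBot ℕ) :=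
    degree_sum_fin_lt _
  have hnat : C.filterPoly.natDegree < r + 1 := by
    refine Nat.lt_succ_of_le (natDegree_le_of_degree_le ?_)
    exact (degree_add_le _ _).trans (max_le (degree_X_pow_le r) hdeg.le)
  rw [jetEval_eq_sum hnat, Finset.sum_range_succ,
    Finset.sum_range (fun i => C.filterPoly.coeff i * errJet y x c i t)]
  have hlast : C.filterPoly.coeff r = 1 := by
    rw [Controller.filterPoly, coeff_add, coeff_eq_zero_of_degree_lt hdeg]
    simp
  have hlow : ∀ i : Fin r, C.filterPoly.coeff i = (C.lam i : ℂ) := by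
    intro i
    rw [Controller.filterPoly, coeff_add, finsetSum_coeff]
    simp [coeff_X_pow, i.2.ne, Fin.val_inj]
  rw [hlast, one_mul]
  simp only [hlow]
  simp only [errJet, Controller.s]
  simp
  refine congrArg₂ _ (Finset.sum_congr rfl fun i _ => rfl) rfl

namespace IsClosedLoopSolution

variable {t₀ : ℝ} {J : Set ℝ} {x : ℝ → FullState r m} {ζ θ : ℝ → ℝ}

theorem errJet_hasDerivWithinAt (hy : IsAdmissibleReference r y)
    (h : IsClosedLoopSolution P C y t₀ J x ζ θ) (c : Fin m) {i : ℕ} (hi : i < r) {t : ℝ}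
    (ht : t ∈ J) : HasDerivWithinAt (errJet y x c i) (errJet y x c (i + 1) t) J t := by
  have h1 := h.errState_castSucc hy ht ⟨i, hi⟩
  have h2 : HasDerivWithinAt (fun τ => errState y (x τ) τ (Fin.castSucc ⟨i, hi⟩) c)
      (errState y (x t) t (Fin.succ ⟨i, hi⟩) c) J t :=
    (EuclideanSpace.proj (𝕜 := ℝ) c).hasFDerivAt.comp_hasDerivWithinAt t h1
  have h3 := h2.ofReal_comp
  have e1 : errJet y x c i = fun τ => ((errState y (x τ) τ (Fin.castSucc ⟨i, hi⟩) c : ℝ) : ℂ) := by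
    funext τ
    rw [errJet, dif_pos (by omega)]
    rfl
  have e2 : errJet y x c (i + 1) t = ((errState y (x t) t (Fin.succ ⟨i, hi⟩) c : ℝ) : ℂ) := by
    rw [errJet, dif_pos (by omega)]
    rfl
  rw [e1, e2]
  exact h3

/-- Up to scaling, ζ itself is the energy certificate, because ζ' ≥ σ₁k‖s‖² and ζ stays in [0, Z].
-/
theorem s_energyBoundedOn (hC : C.IsAdmissible) (h : IsClosedLoopSolution P C y t₀ J x ζ θ)
    {Z : ℝ} (hZ : ∀ t ∈ J, ζ t ≤ Z) (c : Fin m) :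
    EnergyBoundedOn J (jetEval C.filterPoly (errJet y x c)) (Z / (C.σ₁ * C.k)) := by
  have hpos : 0 < C.σ₁ * C.k := mul_pos hC.σ₁_pos hC.k_pos
  refine ⟨fun t => ζ t / (C.σ₁ * C.k), fun t => C.zetaRate y (x t) (θ t) t / (C.σ₁ * C.k),
    fun t ht => (h.zeta t ht).div_const _, fun t ht => ?_, fun t ht =>
    ⟨div_nonneg (h.zeta_nonneg_of_mem hC ht) hpos.le,
      div_le_div_of_nonneg_right (hZ t ht) hpos.le⟩⟩
  rw [jetEval_filterPoly, Complex.norm_real, le_div_iff₀ hpos, mul_comm]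
  refine le_trans ?_ (hC.le_zetaRate y (x t) (h.theta_nonneg_of_mem hC ht) (h.nonneg_of_mem ht))
  gcongr
  exact PiLp.norm_apply_le _ c

end IsClosedLoopSolution

theorem norm_le_of_forall_apply_le {v : Vec m} {B : ℝ} (hv : ∀ c, ‖v c‖ ≤ B) :
    ‖v‖ ≤ Real.sqrt (m * B ^ 2) := by
  rw [EuclideanSpace.norm_eq]
  refine Real.sqrt_le_sqrt ?_
  calc ∑ c, ‖v c‖ ^ 2 ≤ ∑ _c : Fin m, B ^ 2 :=
        Finset.sum_le_sum fun c _ => pow_le_pow_left₀ (norm_nonneg _) (hv c) 2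
    _ = m * B ^ 2 := by simp

theorem norm_errJet_castSucc (y : ℝ → Vec m) (x : ℝ → FullState r m) (c : Fin m) (i : Fin r)
    (t : ℝ) : errJet y x c i t = ((errState y (x t) t i.castSucc c : ℝ) : ℂ) := by
  rw [errJet, dif_pos (by omega)]
  rfl

/-- The errors below the top order are bounded in terms of the initial state and of `ζ`. -/
theorem exists_low_error_bound (hC : C.IsAdmissible) (hy : IsAdmissibleReference r y) (R Z : ℝ) :
    ∃ B, 0 ≤ B ∧ ∀ (t₀ : ℝ) (J : Set ℝ) (x : ℝ → FullState r m) (ζ θ : ℝ → ℝ),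
        IsClosedLoopSolution P C y t₀ J x ζ θ → (∀ i, ‖x t₀ i‖ ≤ R) → (∀ t ∈ J, ζ t ≤ Z) →
        ∀ t ∈ J, ∀ i : Fin r, ‖errState y (x t) t i.castSucc‖ ≤ B := by
  obtain ⟨S, hS0, hS⟩ := exists_static_bound hC hy R
  obtain ⟨W, hW, hcard, hre⟩ := Controller.exists_filter_roots hC
  obtain ⟨B, hB⟩ := jet_bounded W hre S (Z / (C.σ₁ * C.k))
  refine ⟨Real.sqrt (m * B ^ 2), Real.sqrt_nonneg _, ?_⟩
  intro t₀ J x ζ θ h hx hZ t ht i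
  refine norm_le_of_forall_apply_le fun c => ?_
  have := hB t₀ J (errJet y x c) h.isLeast h.ordConnected
    (fun j hj τ hτ => h.errJet_hasDerivWithinAt hy c (hcard ▸ hj) hτ) (fun j hj => ?_)
    (by rw [hW]; exact h.s_energyBoundedOn hC hZ c) i (by rw [hcard]; exact i.2) t ht
  · rwa [norm_errJet_castSucc, Complex.norm_real] at this
  · rw [hcard] at hj
    rw [norm_errJet_castSucc y x c ⟨j, hj⟩, Complex.norm_real]
    exact (PiLp.norm_apply_le _ c).trans ((hS _ _ h.start_nonneg hx).1 _)

theorem low_error_tendsto_zero (hC : C.IsAdmissible) (hy : IsAdmissibleReference r y)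
    {t₀ Z M : ℝ} {x : ℝ → FullState r m} {ζ θ : ℝ → ℝ}
    (h : IsClosedLoopSolution P C y t₀ (Ici t₀) x ζ θ) (hZ : ∀ t ∈ Ici t₀, ζ t ≤ Z)
    (hM : ∀ t ∈ Ici t₀, ‖C.s y (x t) t‖ ≤ M) (i : Fin r) :
    Tendsto (fun t => errState y (x t) t i.castSucc) atTop (𝓝 0) := by
  obtain ⟨W, hW, hcard, hre⟩ := Controller.exists_filter_roots hC
  have hcomp : ∀ c, Tendsto (fun t => errState y (x t) t i.castSucc c) atTop (𝓝 0) := by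
    intro c
    have := jet_tendsto_zero W hre (e := errJet y x c) (Z / (C.σ₁ * C.k)) M
      (fun j hj τ hτ => h.errJet_hasDerivWithinAt hy c (hcard ▸ hj) hτ)
      (by rw [hW]; exact h.s_energyBoundedOn hC hZ c) (fun t ht => ?_) i (by rw [hcard]; exact i.2)
    · have h2 := (Complex.continuous_re.tendsto 0).comp this
      rw [Complex.zero_re] at h2
      refine h2.congr fun t => ?_
      rw [Function.comp_apply, norm_errJet_castSucc, Complex.ofReal_re]
    · rw [hW, jetEval_filterPoly, Complex.norm_real]
      exact (PiLp.norm_apply_le _ c).trans (hM t ht)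
  have h1 : Tendsto (fun t => (errState y (x t) t i.castSucc).ofLp) atTop (𝓝 0) :=
    tendsto_pi_nhds.2 hcomp
  have h2 := ((PiLp.continuous_toLp 2 fun _ : Fin m => ℝ).tendsto 0).comp h1
  rw [WithLp.toLp_zero] at h2
  exact h2

end Filter

/-! ### Uniform boundedness and convergence -/

section Conclusions

variable {r m : ℕ} {P : Plant r m} {C : Controller r m} {y : ℝ → Vec m}
  {α : (Fin r → Vec m) → ℝ → Matrix (Fin m) (Fin m) ℝ} {lo hi L : ℝ}

/-- The states and the adaptive parameters are uniformly bounded. -/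
theorem exists_state_bound (hC : C.IsAdmissible) (hy : IsAdmissibleReference r y)
    (hlo : 0 < lo) (hα : IsAuxiliaryMatrix P α lo hi) (hgrowth : GrowthBounds P C α)
    (hL : hi / lo < L) (hN : IsBLNussbaum L C.h) (R : ℝ) :
    ∃ B Z, 0 ≤ Z ∧ ∀ (t₀ : ℝ) (J : Set ℝ) (x : ℝ → FullState r m) (ζ θ : ℝ → ℝ),
        IsClosedLoopSolution P C y t₀ J x ζ θ → (∀ i, ‖x t₀ i‖ ≤ R) → ζ t₀ ≤ R → θ t₀ ≤ R →
        ∀ t ∈ J, (∀ i, ‖x t i‖ ≤ B) ∧ ζ t ≤ Z ∧ θ t ≤ Z := by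
  obtain ⟨Z, hZ0, hZ⟩ := exists_parameter_bound hC hy hlo hα hgrowth hL hN R
  obtain ⟨M, hM0, hM⟩ := hy.exists_bound
  obtain ⟨E, hE0, hE⟩ := exists_low_error_bound (P := P) hC hy R Z
  obtain ⟨c, hc, hcα⟩ := hα.locally_uniform (E + M)
  set Λ := ∑ i : Fin r, |C.lam i| with hΛ
  refine ⟨max (E + M) (Real.sqrt (Z / c) + Λ * E + M), Z, hZ0, ?_⟩
  intro t₀ J x ζ θ h hx hζ hθ t ht
  have hZt := hZ t₀ J x ζ θ h hx hζ hθ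
  have ht0 := h.nonneg_of_mem ht
  have he := hE t₀ J x ζ θ h hx (fun τ hτ => (hZt τ hτ).1) t ht
  have hstate : ∀ (i : Fin (r + 1)) (b : ℝ), ‖errState y (x t) t i‖ ≤ b → ‖x t i‖ ≤ b + M := by
    intro i b hb
    rw [show x t i = errState y (x t) t i + refDeriv y i t by simp [errState]]
    exact (norm_add_le _ _).trans (add_le_add hb (hM i (by have := i.2; omega) t ht0))
  have hlow : ∀ i : Fin r, ‖x t i.castSucc‖ ≤ E + M := fun i => hstate _ _ (he i)
  -- α depends on the partial state only, so the bounds on the lower errors suffice for its uniform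
  -- positivity; this avoids circularity in bounding `s`.
  have hpsd := hcα (lowState (x t)) t ((pi_norm_le_iff_of_nonneg (by positivity)).2 hlow) ht0
  have hs : ‖C.s y (x t) t‖ ≤ Real.sqrt (Z / c) := by
    refine Real.le_sqrt_of_sq_le ?_
    rw [le_div_iff₀ hc, mul_comm]
    exact (le_inner_matrixAction hpsd _).trans (hZt t ht).2.2
  have hlast : ‖errState y (x t) t (Fin.last r)‖ ≤ Real.sqrt (Z / c) + Λ * E := by
    rw [show errState y (x t) t (Fin.last r) = C.s y (x t) t -
      ∑ i : Fin r, C.lam i • errState y (x t) t i.castSucc by simp [Controller.s]]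
    refine (norm_sub_le _ _).trans (add_le_add hs ?_)
    rw [hΛ, Finset.sum_mul]
    refine (norm_sum_le _ _).trans (Finset.sum_le_sum fun i _ => ?_)
    rw [norm_smul, Real.norm_eq_abs]
    gcongr
    exact he i
  refine ⟨fun i => ?_, (hZt t ht).1, (hZt t ht).2.1⟩
  induction i using Fin.lastCases with
  | last => exact (hstate _ _ hlast).trans (le_max_right _ _)
  | cast i => exact (hlow i).trans (le_max_left _ _)

theorem exists_signals_bound (hC : C.IsAdmissible) (hy : IsAdmissibleReference r y)
    (hlo : 0 < lo) (hα : IsAuxiliaryMatrix P α lo hi) (hgrowth : GrowthBounds P C α)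
    (hL : hi / lo < L) (hN : IsBLNussbaum L C.h) (R : ℝ) :
    ∃ B, ∀ (t₀ : ℝ) (J : Set ℝ) (x : ℝ → FullState r m) (ζ θ : ℝ → ℝ),
        IsClosedLoopSolution P C y t₀ J x ζ θ → (∀ i, ‖x t₀ i‖ ≤ R) → ζ t₀ ≤ R → θ t₀ ≤ R →
        ∀ t ∈ J, SignalsBoundedBy C y B (x t) (ζ t) (θ t) t := by
  obtain ⟨B, Z, hZ0, hB⟩ := exists_state_bound hC hy hlo hα hgrowth hL hN R
  obtain ⟨S, hS0, hS⟩ := exists_static_bound hC hy B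
  obtain ⟨H, hH⟩ := (isCompact_Icc (a := (0 : ℝ)) (b := Z)).exists_bound_of_continuousOn
    (hN.contDiffOn.continuousOn.mono Icc_subset_Ici_self)
  have hk := hC.k_pos
  have h1 := hC.σ₁_pos
  have h2 := hC.σ₂_pos
  have hH0 : 0 ≤ H := (norm_nonneg _).trans (hH 0 ⟨le_rfl, hZ0⟩)
  set N := C.k * S + Z * S with hNdef
  have hN0 : 0 ≤ N := by positivity
  have q1 : 0 ≤ H * N := by positivity
  have q2 : 0 ≤ C.σ₁ * (S * N) := by positivity
  have q3 : 0 ≤ C.σ₂ * (S * S) := by positivity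
  refine ⟨|B| + Z + S + N + H * N + C.σ₁ * (S * N) + C.σ₂ * (S * S), ?_⟩
  intro t₀ J x ζ θ h hx hζ hθ t ht
  obtain ⟨hxB, hζZ, hθZ⟩ := hB t₀ J x ζ θ h hx hζ hθ t ht
  have ht0 := h.nonneg_of_mem ht
  have hθ0 := h.theta_nonneg_of_mem hC ht
  have hζ0 := h.zeta_nonneg_of_mem hC ht
  obtain ⟨he, hs, hΦ, hcore, -, -⟩ := hS (x t) t ht0 hxB
  have hcore0 := hC.core_nonneg y (x t) t
  have hη : ‖C.eta y (x t) (θ t) t‖ ≤ N := by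
    refine (hC.norm_eta_le y (x t) hθ0 ht0).trans ?_
    rw [hNdef]
    gcongr
  have hu : ‖C.control y (x t) (ζ t) (θ t) t‖ ≤ H * N := by
    rw [Controller.control, norm_smul]
    gcongr
    exact hH _ ⟨hζ0, hζZ⟩
  have hζr : |C.zetaRate y (x t) (θ t) t| ≤ C.σ₁ * (S * N) := by
    rw [Controller.zetaRate, abs_mul, abs_of_pos h1]
    gcongr
    exact (abs_real_inner_le_norm _ _).trans (by gcongr)
  have hθr : |C.thetaRate y (x t) t| ≤ C.σ₂ * (S * S) := by
    rw [abs_of_nonneg (hC.thetaRate_nonneg y (x t) ht0)]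
    refine (hC.thetaRate_le y (x t) ht0).trans ?_
    gcongr
  have hBB := le_abs_self B
  have hB0 := abs_nonneg B
  refine ⟨fun i => (hxB i).trans (by linarith), fun i => (he i).trans (by linarith), by linarith,
    by linarith, ?_, by linarith, by linarith, ?_, ?_, by linarith, by linarith⟩
  · rw [abs_of_nonneg hcore0]; linarith
  · rw [abs_of_nonneg hζ0]; linarith
  · rw [abs_of_nonneg hθ0]; linarith

theorem exists_accel_bound (hC : C.IsAdmissible) (hy : IsAdmissibleReference r y)
    (hlo : 0 < lo) (hα : IsAuxiliaryMatrix P α lo hi) (hgrowth : GrowthBounds P C α)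
    (hL : hi / lo < L) (hN : IsBLNussbaum L C.h)
    (hg : ∀ R : ℝ, ∃ G : ℝ, ∀ x t, ‖x‖ ≤ R → 0 ≤ t → ‖P.g x t‖ ≤ G) (R : ℝ) :
    ∃ B, ∀ (t₀ : ℝ) (J : Set ℝ) (x : ℝ → FullState r m) (ζ θ : ℝ → ℝ),
        IsClosedLoopSolution P C y t₀ J x ζ θ → (∀ i, ‖x t₀ i‖ ≤ R) → ζ t₀ ≤ R → θ t₀ ≤ R →
        ∀ t ∈ J, ‖accel P C y (x t) (ζ t) (θ t) t‖ ≤ B := by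
  obtain ⟨B, hB⟩ := exists_signals_bound hC hy hlo hα hgrowth hL hN R
  obtain ⟨af, -, -, haf, -, -, hf, -, -⟩ := hgrowth
  obtain ⟨G, hG⟩ := hg B
  obtain ⟨F, hF⟩ := hC.φf_bounded B
  refine ⟨af * F + G * B, ?_⟩
  intro t₀ J x ζ θ h hx hζ hθ t ht
  obtain ⟨hxB, -, -, -, -, -, hu, -⟩ := hB t₀ J x ζ θ h hx hζ hθ t ht
  have ht0 := h.nonneg_of_mem ht
  have hxn := norm_fullState_le hxB
  have hGt := hG _ t hxn ht0
  -- The growth condition bounds f + d only as a sum, so the two are brought together.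
  rw [accel, add_right_comm]
  refine (norm_add_le _ _).trans (add_le_add ((hf _ t ht0).trans ?_) ?_)
  · gcongr
    exact hF _ hxn
  · refine ((matrixAction m (P.g (x t) t)).le_opNorm _).trans ?_
    rw [norm_matrixAction]
    exact mul_le_mul hGt hu (norm_nonneg _) ((norm_nonneg _).trans hGt)

/-- The errors of all orders tend to zero along solutions on a half-line. -/
theorem errState_tendsto_zero (hC : C.IsAdmissible) (hy : IsAdmissibleReference r y)
    (hlo : 0 < lo) (hα : IsAuxiliaryMatrix P α lo hi) (hgrowth : GrowthBounds P C α)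
    (hL : hi / lo < L) (hN : IsBLNussbaum L C.h) {t₀ : ℝ} {x : ℝ → FullState r m} {ζ θ : ℝ → ℝ}
    (h : IsClosedLoopSolution P C y t₀ (Ici t₀) x ζ θ) (i : Fin (r + 1)) :
    Tendsto (fun t => errState y (x t) t i) atTop (𝓝 0) := by
  obtain ⟨R, hRx, hRζ, hRθ⟩ : ∃ R, (∀ i, ‖x t₀ i‖ ≤ R) ∧ ζ t₀ ≤ R ∧ θ t₀ ≤ R :=
    ⟨max ‖x t₀‖ (max (ζ t₀) (θ t₀)), fun i => (norm_le_pi_norm _ i).trans (le_max_left _ _),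
      (le_max_left _ _).trans (le_max_right _ _), (le_max_right _ _).trans (le_max_right _ _)⟩
  obtain ⟨B, hB⟩ := exists_signals_bound hC hy hlo hα hgrowth hL hN R
  replace hB := hB t₀ (Ici t₀) x ζ θ h hRx hRζ hRθ
  obtain ⟨B', Z, hZ0, hB'⟩ := exists_state_bound hC hy hlo hα hgrowth hL hN R
  replace hB' := hB' t₀ (Ici t₀) x ζ θ h hRx hRζ hRθ
  obtain ⟨S, hS0, hS⟩ := exists_static_bound hC hy B'
  have hσ₁ := hC.σ₁_pos
  have hk := hC.k_pos
  obtain ⟨g, c, hNg, hc, hder⟩ := exists_lyapunov_deriv_le hC hy hα hgrowth hN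
  choose! V' hV hV' using hder t₀ (Ici t₀) x ζ θ h
  obtain ⟨-, a₁, -, -, ha₁, -, -, hA, -⟩ := hgrowth
  obtain ⟨H, hH⟩ : ∃ H, ∀ z ∈ Icc 0 Z, ‖(hi * max 0 (g z) - lo * max 0 (-g z)) / C.σ₁‖ ≤ H := by
    have hg : ContinuousOn g (Icc 0 Z) := hNg.contDiffOn.continuousOn.mono Icc_subset_Ici_self
    exact isCompact_Icc.exists_bound_of_continuousOn (((continuousOn_const.mul
      ((continuous_const.max continuous_id).comp_continuousOn hg)).sub (continuousOn_const.mul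
        ((continuous_const.max continuous_id).comp_continuousOn hg.neg))).div_const _)
  have hzero : ∀ t ∈ Ici t₀, 0 ≤ lyapunov C y α (x t) t := fun t ht =>
    lyapunov_nonneg hα (x t) (h.nonneg_of_mem ht)
  -- No bound on g enters: the control term is estimated through ζ', which is bounded, and the
  -- Nussbaum gain on the compact range of ζ.
  have hVc : ∀ t ∈ Ici t₀, V' t ≤ c * (S * S) + H * B := by
    intro t ht
    obtain ⟨-, hs, -, hcore, -, -⟩ := hS (x t) t (h.nonneg_of_mem ht) (hB' t ht).1
    obtain ⟨-, -, -, -, -, -, -, -, -, hζr, -⟩ := hB t ht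
    refine (hV' t ht).trans (add_le_add ?_ ?_)
    · gcongr
    · have hHt := hH (ζ t) ⟨h.zeta_nonneg_of_mem hC ht, (hB' t ht).2.1⟩
      refine (le_abs_self _).trans ?_
      rw [abs_mul]
      exact mul_le_mul hHt hζr (abs_nonneg _) ((norm_nonneg _).trans hHt)
  have hVζ : ∀ t ∈ Ici t₀, lyapunov C y α (x t) t ≤
      a₁ * S / (C.σ₁ * C.k) * C.zetaRate y (x t) (θ t) t := by
    intro t ht
    obtain ⟨-, hs, -, -, h1, -⟩ := hS (x t) t (h.nonneg_of_mem ht) (hB' t ht).1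
    have h2 : ‖α (lowState (x t)) t‖ ≤ a₁ * S :=
      (hA _ _ (h.nonneg_of_mem ht)).trans (by gcongr)
    have h3 := hC.le_zetaRate y (x t) (h.theta_nonneg_of_mem hC ht) (h.nonneg_of_mem ht)
    calc lyapunov C y α (x t) t ≤ ‖α (lowState (x t)) t‖ * (‖C.s y (x t) t‖ * ‖C.s y (x t) t‖) :=
          inner_matrixAction_le_norm _ _ _
      _ ≤ a₁ * S * (‖C.s y (x t) t‖ * ‖C.s y (x t) t‖) := by gcongr
      _ = a₁ * S / (C.σ₁ * C.k) * (C.σ₁ * C.k * ‖C.s y (x t) t‖ ^ 2) := by field_simp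
      _ ≤ _ := by gcongr
  have hVlim := tendsto_zero_of_le_deriv hV hVc hzero
    (fun t ht => (h.zeta t ht).const_mul (a₁ * S / (C.σ₁ * C.k))) hVζ
    (K := a₁ * S / (C.σ₁ * C.k) * Z) (fun t ht =>
      mul_le_mul_of_nonneg_left (hB' t ht).2.1 (by positivity))
  obtain ⟨b, hb, hbα⟩ := hα.locally_uniform B'
  have hslim : Tendsto (fun t => C.s y (x t) t) atTop (𝓝 0) := by
    rw [tendsto_zero_iff_norm_tendsto_zero]
    have h1 := (hVlim.div_const b).sqrt
    rw [zero_div, Real.sqrt_zero] at h1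
    refine squeeze_zero' (Eventually.of_forall fun t => norm_nonneg _) ?_ h1
    filter_upwards [eventually_ge_atTop t₀] with t ht
    refine Real.le_sqrt_of_sq_le ?_
    rw [le_div_iff₀ hb, mul_comm]
    exact le_inner_matrixAction
      (hbα _ t (norm_lowState_le (hB' t ht).1) (h.nonneg_of_mem ht)) _
  have hlow := low_error_tendsto_zero hC hy h (fun t ht => (hB' t ht).2.1)
    (fun t ht => (hS (x t) t (h.nonneg_of_mem ht) (hB' t ht).1).2.1)
  induction i using Fin.lastCases with
  | cast i => exact hlow i
  | last =>
    have h1 := hslim.sub (tendsto_finsetSum Finset.univ fun i (_ : i ∈ Finset.univ) =>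
      (hlow i).const_smul (C.lam i))
    simp only [smul_zero, Finset.sum_const_zero, sub_zero] at h1
    refine h1.congr fun t => ?_
    simp [Controller.s]

/-- The reference is differentiated within [0, ∞) but the error within [t₀, ∞). At each order the
derivative restricts to the smaller half-line, where it is unique. -/
theorem iteratedDerivWithin_error (hy : IsAdmissibleReference r y) {t₀ : ℝ}
    {x : ℝ → FullState r m} {ζ θ : ℝ → ℝ}
    (h : IsClosedLoopSolution P C y t₀ (Ici t₀) x ζ θ) (i : ℕ) (hi : i < r + 1) :
    ∀ t ∈ Ici t₀, iteratedDerivWithin i (fun τ => x τ 0 - y τ) (Ici t₀) t =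
      errState y (x t) t ⟨i, hi⟩ := by
  induction i with
  | zero =>
    intro t ht
    simp [errState, refDeriv]
  | succ i ih =>
    intro t ht
    rw [iteratedDerivWithin_succ, derivWithin_congr (ih (by omega)) (ih (by omega) t ht)]
    exact (h.errState_castSucc hy ht ⟨i, by omega⟩).derivWithin (uniqueDiffOn_Ici t₀ t ht)

end Conclusions

theorem theorem1 {r m : ℕ} (P : Plant r m) (C : Controller r m) (y : ℝ → Vec m)
    (α : (Fin r → Vec m) → ℝ → Matrix (Fin m) (Fin m) ℝ) (lo hi L : ℝ)
    (hC : C.IsAdmissible)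
    (hy : IsAdmissibleReference r y)
    (hlo : 0 < lo) (hα : IsAuxiliaryMatrix P α lo hi)
    (hgrowth : GrowthBounds P C α)
    (hL : hi / lo < L) (hN : IsBLNussbaum L C.h) :
    -- global uniform boundedness of all signals, on every interval of existence
    (∀ R : ℝ, ∃ B : ℝ, ∀ (t₀ : ℝ) (J : Set ℝ) (x : ℝ → FullState r m) (ζ θ : ℝ → ℝ),
      IsClosedLoopSolution P C y t₀ J x ζ θ →
      (∀ i, ‖x t₀ i‖ ≤ R) → ζ t₀ ≤ R → θ t₀ ≤ R →
      ∀ t ∈ J, SignalsBoundedBy C y B (x t) (ζ t) (θ t) t) ∧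
    -- the same for the state derivative if the gain is bounded on bounded sets of states
    ((∀ R : ℝ, ∃ G : ℝ, ∀ x t, ‖x‖ ≤ R → 0 ≤ t → ‖P.g x t‖ ≤ G) →
      ∀ R : ℝ, ∃ B : ℝ, ∀ (t₀ : ℝ) (J : Set ℝ) (x : ℝ → FullState r m) (ζ θ : ℝ → ℝ),
        IsClosedLoopSolution P C y t₀ J x ζ θ →
        (∀ i, ‖x t₀ i‖ ≤ R) → ζ t₀ ≤ R → θ t₀ ≤ R →
        ∀ t ∈ J, ‖accel P C y (x t) (ζ t) (θ t) t‖ ≤ B) ∧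
    -- the tracking error and its derivatives up to order `n - 1` tend to zero
    (∀ (t₀ : ℝ) (x : ℝ → FullState r m) (ζ θ : ℝ → ℝ),
      IsClosedLoopSolution P C y t₀ (Ici t₀) x ζ θ →
      ∀ i ≤ r, Tendsto (iteratedDerivWithin i (fun τ => x τ 0 - y τ) (Ici t₀)) atTop (𝓝 0)) := by
  refine ⟨exists_signals_bound hC hy hlo hα hgrowth hL hN,
    exists_accel_bound hC hy hlo hα hgrowth hL hN, fun t₀ x ζ θ h i hi => ?_⟩
  have hi' : i < r + 1 := Nat.lt_succ_of_le hi
  refine (errState_tendsto_zero hC hy hlo hα hgrowth hL hN h ⟨i, hi'⟩).congr' ?_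
  filter_upwards [eventually_ge_atTop t₀] with t ht
  exact (iteratedDerivWithin_error hy h i hi' t ht).symm
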